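/- **Theorem.** A planar 5-web on an open set $D\subset\mathbb R^2$ consists of five foliations, given by smooth 1-forms $\omega_1,\dots,\omega_5$ on $D$ (each determined up to multiplication by a nonvanishing function), any two of which are linearly independent at every point. After rescaling, the forms can be normalized so that $$\omega_1+\omega_2+\omega_3=0,\qquad a\,\omega_1+\omega_2+\omega_4=0,\qquad b\,\omega_1+\omega_2+\omega_5=0;$$ the functions $a,b$ (cross-ratios of covectors) are the *basic invariants* of the web. The *rank* of the web at $p\in D$ is the dimension of the space of germs at $p$ of smooth solutions $(\lambda_1,\dots,\lambda_5)$ of the abelian equation $\sum_i\lambda_i\omega_i=0$, $d(\lambda_i\omega_i)=0$ for $i=1,\dots,5$; its maximum possible value is six. The web is *parallelizable* at $p$ if a diffeomorphism from a neighbourhood of $p$ onto an open subset of the plane maps each of the five foliations to a family of parallel straight lines. Suppose that both basic invariants $a$ and $b$ are constant. Then: (1) For every $p\in D$, the rank of the web at $p$ is six if and only if the web is parallelizable at $p$. In particular, the web has maximum rank at every point of $D$ if and only if it is locally parallelizable. (2) A normalization as above exists on $D$. Consider any such normalization on an open set $U\subseteq D$. Let $\partial_1,\partial_2$ be the basis dual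 to $\omega_1,\omega_2$; let $\gamma=g_1\omega_1+g_2\omega_2$ be the unique 1-form with $d\omega_i=\omega_i\wedge\gamma$ $(i=1,2,3)$; define the curvature function $K$, of weight $2$, by $d\gamma=K\,\omega_1\wedge\omega_2$; and let $\delta_i u=\partial_i u-k\,g_i\,u$ for a function $u$ of weight $k$ (then $\delta_iu$ has weight $k+1$). Write $\Delta_1=\delta_1-\delta_2$, $\Delta_2=\delta_1-\delta_2\circ a$, $\Delta_3=\delta_1-\delta_2\circ b$. With $(\lambda_1,\dots,\lambda_5)=(w+au+bv,\;w+u+v,\;w,\;u,\;v)$, where $w,u,v$ have weight $1$, the abelian equation becomes $$\Delta_1w=\Delta_2u=\Delta_3v=0,\qquad \delta_1w+\delta_1u+\delta_1v=0 .$$ Let $\mathfrak A_3$ be the set of 3-jets of triples $(w,u,v)$ that satisfy these four equations together with all their derivatives of order at most two. The obstruction $$\varkappa=(\Delta_1\Delta_2\Delta_3\delta_1-\delta_1\Delta_2\Delta_3\Delta_1)w+(\Delta_1\Delta_2\Delta_3\delta_1-\Delta_1\delta_1\Delta_3\Delta_2)u+(\Delta_1\Delta_2\Delta_3\delta_1-\Delta_1\Delta_2\delta_1\Delta_3)v$$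 restricts to $\mathfrak A_3$, at every point of $U$, as $$\varkappa=-10(a-1)(b-1)\,\bigl(c_0\,\delta_2\delta_2w+c_1\,\delta_2w+c_2\,\delta_2v+c_3\,w+c_4\,u+c_5\,v\bigr)$$ with uniquely determined functions $c_0,\dots,c_5$ on $U$. Writing $K_i=\delta_iK$ and $K_{ij}=\tfrac12(\delta_i\delta_j+\delta_j\delta_i)K$, these coefficients are $$c_0=K,\qquad c_1=\frac{bK_2-K_1}{2(b-1)},\qquad c_2=\frac{b(a-b)(K_2-K_1)}{2(a-1)(b-1)},$$ $$c_3=\frac{K_{11}-(a+b)K_{12}+ab\,K_{22}+5(a+b-2)K^2}{10(a-1)(b-1)},$$ $$c_4=\frac{a\bigl(K_{11}-(b+1)K_{12}+b\,K_{22}+5(b-1)K^2\bigr)}{10(a-1)(b-1)},\qquad c_5=\frac{b\bigl(K_{11}-(a+1)K_{12}+a\,K_{22}+5(a-1)K^2\bigr)}{10(a-1)(b-1)} .$$ Moreover, $c_0,\dots,c_5$ all vanish identically on $U$ if and only if $K=0$ on $U$. -/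

import Mathlib

open scoped ContDiff Topology

noncomputable section

namespace PlanarWeb

/-! ## Differential forms in the plane -/

/-- A differential 1-form on (a part of) the plane. -/
abbrev OneForm := ℝ × ℝ → (ℝ × ℝ →L[ℝ] ℝ)

/-- The coefficient of `dx ∧ dy` in `α ∧ β`. -/
def wedge (α β : OneForm) (p : ℝ × ℝ) : ℝ :=
  α p (1, 0) * β p (0, 1) - α p (0, 1) * β p (1, 0)

/-- The coefficient of `dx ∧ dy` in the exterior derivative `dη`. -/
def dForm (η : OneForm) (p : ℝ × ℝ) : ℝ :=
  fderiv ℝ (fun q => η q (0, 1)) p (1, 0) - fderiv ℝ (fun q => η q (1, 0)) p (0, 1)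

/-- `η` is a smooth closed 1-form on `U`. -/
def IsClosedFormOn (η : OneForm) (U : Set (ℝ × ℝ)) : Prop :=
  ContDiffOn ℝ ∞ η U ∧ ∀ q ∈ U, dForm η q = 0

/-! ## Webs -/

/-- A planar `d`-web on the open set `D`: `d` foliations `W i = 0` in general position, given by
smooth 1-forms any two of which are linearly independent at every point. Only the kernels of the
forms matter; rescaling a form does not change the web. -/
structure IsWeb {d : ℕ} (D : Set (ℝ × ℝ)) (W : Fin d → OneForm) : Prop where
  isOpen : IsOpen D
  smooth : ∀ i, ContDiffOn ℝ ∞ (W i) D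
  transversal : ∀ q ∈ D, ∀ i j, i ≠ j → LinearIndependent ℝ ![W i q, W j q]

/-- Local parallelizability at `p`: some diffeomorphism `φ` from a neighbourhood of `p` in `D` onto
an open set of the plane maps the `i`-th foliation to the parallel straight lines `ℓ i = const`,
for every `i`. -/
def IsParallelizableAt {d : ℕ} (D : Set (ℝ × ℝ)) (W : Fin d → OneForm) (p : ℝ × ℝ) : Prop :=
  ∃ φ : OpenPartialHomeomorph (ℝ × ℝ) (ℝ × ℝ),
    p ∈ φ.source ∧ φ.source ⊆ D ∧
    ContDiffOn ℝ ∞ φ φ.source ∧ ContDiffOn ℝ ∞ φ.symm φ.target ∧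
    ∃ ℓ : Fin d → (ℝ × ℝ →L[ℝ] ℝ), (∀ i, ℓ i ≠ 0) ∧
      ∀ i, ∀ q ∈ φ.source, ∀ v : ℝ × ℝ, W i q v = 0 ↔ ℓ i (fderiv ℝ φ q v) = 0

/-! ## The abelian equation and the rank -/

/-- `lam = (λ₁, …, λ_d)` solves the abelian equation of the web on `U`: the functions are smooth,
`∑ λᵢ ωᵢ = 0`, and every `λᵢ ωᵢ` is closed. -/
structure IsAbelianSolution {d : ℕ} (W : Fin d → OneForm) (U : Set (ℝ × ℝ))
    (lam : ℝ × ℝ → Fin d → ℝ) : Prop where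
  smooth : ContDiffOn ℝ ∞ lam U
  sum_eq_zero : ∀ q ∈ U, ∑ i, lam q i • W i q = 0
  closed : ∀ i, IsClosedFormOn (fun q => lam q i • W i q) U

theorem IsClosedFormOn.mono {η : OneForm} {U V : Set (ℝ × ℝ)} (h : IsClosedFormOn η U)
    (hV : V ⊆ U) : IsClosedFormOn η V :=
  ⟨h.1.mono hV, fun q hq => h.2 q (hV hq)⟩

theorem IsAbelianSolution.mono {d : ℕ} {W : Fin d → OneForm} {U V : Set (ℝ × ℝ)}
    {lam : ℝ × ℝ → Fin d → ℝ} (h : IsAbelianSolution W U lam) (hV : V ⊆ U) :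
    IsAbelianSolution W V lam :=
  ⟨h.smooth.mono hV, fun q hq => h.sum_eq_zero q (hV hq), fun i => (h.closed i).mono hV⟩

theorem differentiableAt_coeff {η : OneForm} {U : Set (ℝ × ℝ)} (hU : IsOpen U)
    (h : ContDiffOn ℝ ∞ η U) {q : ℝ × ℝ} (hq : q ∈ U) (v : ℝ × ℝ) :
    DifferentiableAt ℝ (fun x => η x v) q := by
  have h1 : DifferentiableAt ℝ η q :=
    (h.contDiffAt (hU.mem_nhds hq)).differentiableAt (by simp)
  exact h1.clm_apply (differentiableAt_const v)

theorem IsClosedFormOn.add {η θ : OneForm} {U : Set (ℝ × ℝ)} (hU : IsOpen U)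
    (hη : IsClosedFormOn η U) (hθ : IsClosedFormOn θ U) :
    IsClosedFormOn (fun q => η q + θ q) U := by
  refine ⟨hη.1.add hθ.1, fun q hq => ?_⟩
  have e1 := hη.2 q hq
  have e2 := hθ.2 q hq
  simp only [dForm, add_apply] at e1 e2 ⊢
  rw [fderiv_fun_add (differentiableAt_coeff hU hη.1 hq _) (differentiableAt_coeff hU hθ.1 hq _),
    fderiv_fun_add (differentiableAt_coeff hU hη.1 hq _) (differentiableAt_coeff hU hθ.1 hq _)]
  simp only [add_apply]
  linarith

theorem IsClosedFormOn.smul {η : OneForm} {U : Set (ℝ × ℝ)} (hU : IsOpen U) (c : ℝ)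
    (hη : IsClosedFormOn η U) : IsClosedFormOn (fun q => c • η q) U := by
  refine ⟨hη.1.const_smul c, fun q hq => ?_⟩
  have e1 := hη.2 q hq
  simp only [dForm, smul_apply, smul_eq_mul] at e1 ⊢
  rw [fderiv_const_mul (differentiableAt_coeff hU hη.1 hq _),
    fderiv_const_mul (differentiableAt_coeff hU hη.1 hq _)]
  simp only [smul_apply, smul_eq_mul]
  rw [← mul_sub, e1, mul_zero]

/-- The vector space of germs at `p` of solutions of the abelian equation. -/
def solutionGerms {d : ℕ} (W : Fin d → OneForm) (p : ℝ × ℝ) :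
    Submodule ℝ ((𝓝 p).Germ (Fin d → ℝ)) where
  carrier := {g | ∃ U : Set (ℝ × ℝ), IsOpen U ∧ p ∈ U ∧
    ∃ lam : ℝ × ℝ → Fin d → ℝ, IsAbelianSolution W U lam ∧
      (lam : (𝓝 p).Germ (Fin d → ℝ)) = g}
  zero_mem' := by
    refine ⟨Set.univ, isOpen_univ, Set.mem_univ p, fun _ => 0, ⟨contDiffOn_const, ?_, ?_⟩, rfl⟩
    · intro q _
      simp
    · intro i
      refine ⟨?_, fun q _ => ?_⟩
      · simpa using contDiffOn_const
      · simp [dForm]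
  add_mem' := by
    rintro _ _ ⟨U, hU, hpU, l, hl, rfl⟩ ⟨V, hV, hpV, m, hm, rfl⟩
    have hl' := hl.mono (Set.inter_subset_left (s := U) (t := V))
    have hm' := hm.mono (Set.inter_subset_right (s := U) (t := V))
    refine ⟨U ∩ V, hU.inter hV, ⟨hpU, hpV⟩, l + m, ⟨hl'.smooth.add hm'.smooth, ?_, ?_⟩, rfl⟩
    · intro q hq
      have e1 := hl'.sum_eq_zero q hq
      have e2 := hm'.sum_eq_zero q hq
      simp [add_smul, Finset.sum_add_distrib, e1, e2]
    · intro i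
      have h := (hl'.closed i).add (hU.inter hV) (hm'.closed i)
      simpa [add_smul] using h
  smul_mem' := by
    rintro c _ ⟨U, hU, hpU, l, hl, rfl⟩
    refine ⟨U, hU, hpU, c • l, ⟨hl.smooth.const_smul c, ?_, ?_⟩, rfl⟩
    · intro q hq
      have e1 := hl.sum_eq_zero q hq
      simp [mul_smul, ← Finset.smul_sum, e1]
    · intro i
      have h := (hl.closed i).smul hU c
      simpa [mul_smul] using h

/-- The rank of the web at `p`: the dimension of the space of (local) solutions of the abelian
equation. -/
def rankAt {d : ℕ} (W : Fin d → OneForm) (p : ℝ × ℝ) : ℕ :=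
  Module.finrank ℝ (solutionGerms W p)

/-! ## Basic invariants and normalizations of a 5-web -/

/-- The cross-ratio at `p` of the lines spanned by the covectors `W 0, W 1, W 2, W i`. If `a` is
such that suitable multiples `ωⱼ` of the `W j` satisfy `ω₁ + ω₂ + ω₃ = 0` and
`a ω₁ + ω₂ + ωᵢ = 0`, then this number is `a`. The basic invariants of a 5-web are the values for
`i = 3` and `i = 4`. -/
def basicInvariant (W : Fin 5 → OneForm) (i : Fin 5) (p : ℝ × ℝ) : ℝ :=
  (wedge (W 0) (W 2) p * wedge (W 1) (W i) p) / (wedge (W 1) (W 2) p * wedge (W 0) (W i) p)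

/-- On `U`, the 1-forms `θ` define the same web as `W` and satisfy
`ω₁ + ω₂ + ω₃ = 0`, `a ω₁ + ω₂ + ω₄ = 0`, `b ω₁ + ω₂ + ω₅ = 0`. The common scale is left free;
one may in particular choose it so that `ω₃` is closed. -/
structure IsNormalization (U : Set (ℝ × ℝ)) (W θ : Fin 5 → OneForm) (a b : ℝ × ℝ → ℝ) :
    Prop where
  smooth : ∀ i, ContDiffOn ℝ ∞ (θ i) U
  scaling : ∀ i, ∀ q ∈ U, ∃ s : ℝ, s ≠ 0 ∧ θ i q = s • W i q
  rel_three : ∀ q ∈ U, θ 0 q + θ 1 q + θ 2 q = 0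
  rel_four : ∀ q ∈ U, a q • θ 0 q + θ 1 q + θ 3 q = 0
  rel_five : ∀ q ∈ U, b q • θ 0 q + θ 1 q + θ 4 q = 0

/-! ## The Chern connection of the 3-subweb `ω₁, ω₂, ω₃ = -ω₁ - ω₂`

All objects depend on the co-basis `ω₁, ω₂`. In `frame`, `connCoeff` and `covD` the indices
`0, 1 : Fin 2` stand for the indices 1, 2. -/

/-- The basis `∂₁, ∂₂` of vector fields dual to `ω₁, ω₂`. -/
def frame (ω₁ ω₂ : OneForm) (i : Fin 2) (p : ℝ × ℝ) : ℝ × ℝ :=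
  (wedge ω₁ ω₂ p)⁻¹ • (![(ω₂ p (0, 1), - ω₂ p (1, 0)), (- ω₁ p (0, 1), ω₁ p (1, 0))] i)

/-- The coefficients of `γ = g₁ ω₁ + g₂ ω₂`, the unique 1-form with `dωᵢ = ωᵢ ∧ γ` for
`i = 1, 2, 3`; these equations say `dω₁ = g₂ ω₁ ∧ ω₂` and `dω₂ = - g₁ ω₁ ∧ ω₂`. -/
def connCoeff (ω₁ ω₂ : OneForm) (i : Fin 2) (p : ℝ × ℝ) : ℝ :=
  ![- (dForm ω₂ p / wedge ω₁ ω₂ p), dForm ω₁ p / wedge ω₁ ω₂ p] i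

/-- The connection form `γ`. -/
def connForm (ω₁ ω₂ : OneForm) : OneForm := fun p =>
  connCoeff ω₁ ω₂ 0 p • ω₁ p + connCoeff ω₁ ω₂ 1 p • ω₂ p

/-- The curvature function `K`, defined by `dγ = K ω₁ ∧ ω₂`. -/
def curvature (ω₁ ω₂ : OneForm) (p : ℝ × ℝ) : ℝ :=
  dForm (connForm ω₁ ω₂) p / wedge ω₁ ω₂ p

/-- The covariant derivative `δᵢ u = ∂ᵢ u - k gᵢ u` of a function `u` of weight `k`; the result has
weight `k + 1`. -/
def covD (ω₁ ω₂ : OneForm) (i : Fin 2) (k : ℕ) (u : ℝ × ℝ → ℝ) : ℝ × ℝ → ℝ := fun p =>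
  fderiv ℝ u p (frame ω₁ ω₂ i p) - k * connCoeff ω₁ ω₂ i p * u p

/-- The covariant derivatives `K₁, K₂` of the curvature function, which has weight two. -/
def curvatureD (ω₁ ω₂ : OneForm) (i : Fin 2) : ℝ × ℝ → ℝ :=
  covD ω₁ ω₂ i 2 (curvature ω₁ ω₂)

/-- The symmetrized second covariant derivatives `K₁₁, K₁₂, K₂₂` of the curvature function. -/
def curvatureDD (ω₁ ω₂ : OneForm) (i j : Fin 2) : ℝ × ℝ → ℝ := fun p =>
  (covD ω₁ ω₂ i 3 (curvatureD ω₁ ω₂ j) p + covD ω₁ ω₂ j 3 (curvatureD ω₁ ω₂ i) p) / 2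

/-! ## The obstruction of a 5-web

In a normalization the solutions of the abelian equation are
`λ = (w + a u + b v, w + u + v, w, u, v)`, where the functions `w, u, v` of weight one satisfy
`Δ₁ w = Δ₂ u = Δ₃ v = 0` and `δ₁ w + δ₁ u + δ₁ v = 0`. -/

/-- The operator `δ₁ - δ₂ ∘ c` on functions of weight `k`, where `c` has weight zero; `Δ₁, Δ₂, Δ₃`
are the cases `c = 1`, `c = a`, `c = b`. -/
def Delta (ω₁ ω₂ : OneForm) (c : ℝ × ℝ → ℝ) (k : ℕ) (u : ℝ × ℝ → ℝ) : ℝ × ℝ → ℝ := fun p =>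
  covD ω₁ ω₂ 0 k u p - covD ω₁ ω₂ 1 k (fun q => c q * u q) p

/-- The left-hand sides of the four equations of the abelian system for `w, u, v`. -/
def abelianSystem (ω₁ ω₂ : OneForm) (a b w u v : ℝ × ℝ → ℝ) : Fin 4 → ℝ × ℝ → ℝ :=
  ![Delta ω₁ ω₂ 1 1 w, Delta ω₁ ω₂ a 1 u, Delta ω₁ ω₂ b 1 v,
    fun p => covD ω₁ ω₂ 0 1 w p + covD ω₁ ω₂ 0 1 u p + covD ω₁ ω₂ 0 1 v p]

/-- The 3-jet of `(w, u, v)` at `q` lies in the second prolongation `𝔄₃` of the abelian system: the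
four equations hold at `q` together with all their derivatives of order at most two. -/
def JetInProlongation (ω₁ ω₂ : OneForm) (a b w u v : ℝ × ℝ → ℝ) (q : ℝ × ℝ) : Prop :=
  ∀ j : Fin 4, ∀ k : ℕ, k ≤ 2 → iteratedFDeriv ℝ k (abelianSystem ω₁ ω₂ a b w u v j) q = 0

/-- The multi-bracket
`ϰ = (Δ₁Δ₂Δ₃δ₁ - δ₁Δ₂Δ₃Δ₁) w + (Δ₁Δ₂Δ₃δ₁ - Δ₁δ₁Δ₃Δ₂) u + (Δ₁Δ₂Δ₃δ₁ - Δ₁Δ₂δ₁Δ₃) v`. -/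
def kappa (ω₁ ω₂ : OneForm) (a b w u v : ℝ × ℝ → ℝ) : ℝ × ℝ → ℝ :=
  let δ₁ := covD ω₁ ω₂ 0
  let Δ₁ := Delta ω₁ ω₂ 1
  let Δ₂ := Delta ω₁ ω₂ a
  let Δ₃ := Delta ω₁ ω₂ b
  fun p =>
    (Δ₁ 4 (Δ₂ 3 (Δ₃ 2 (δ₁ 1 w))) p - δ₁ 4 (Δ₂ 3 (Δ₃ 2 (Δ₁ 1 w))) p) +
    (Δ₁ 4 (Δ₂ 3 (Δ₃ 2 (δ₁ 1 u))) p - Δ₁ 4 (δ₁ 3 (Δ₃ 2 (Δ₂ 1 u))) p) +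
    (Δ₁ 4 (Δ₂ 3 (Δ₃ 2 (δ₁ 1 v))) p - Δ₁ 4 (Δ₂ 3 (δ₁ 2 (Δ₃ 1 v))) p)

/-- `c = (c₀, …, c₅)` are the coefficients at `q` of the obstruction, i.e. of the restriction of
`ϰ` to `𝔄₃`, in the fibre coordinates `w₂₂, w₂, v₂, w, u, v`:
`ϰ = -10 (a - 1) (b - 1) (c₀ w₂₂ + c₁ w₂ + c₂ v₂ + c₃ w + c₄ u + c₅ v)` on `𝔄₃`. The nonvanishing
common factor is the one for which `K` enters `c₀` with coefficient one. -/
def IsObstructionAt (U : Set (ℝ × ℝ)) (ω₁ ω₂ : OneForm) (a b : ℝ × ℝ → ℝ) (q : ℝ × ℝ)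
    (c : Fin 6 → ℝ) : Prop :=
  ∀ w u v : ℝ × ℝ → ℝ, ContDiffOn ℝ ∞ w U → ContDiffOn ℝ ∞ u U → ContDiffOn ℝ ∞ v U →
    JetInProlongation ω₁ ω₂ a b w u v q →
    kappa ω₁ ω₂ a b w u v q = -10 * (a q - 1) * (b q - 1) *
      (c 0 * covD ω₁ ω₂ 1 2 (covD ω₁ ω₂ 1 1 w) q + c 1 * covD ω₁ ω₂ 1 1 w q +
        c 2 * covD ω₁ ω₂ 1 1 v q + c 3 * w q + c 4 * u q + c 5 * v q)

end PlanarWeb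

end

/-! For constant `a, b`, three properties at `p` are equivalent: rank six, vanishing of `K` near
`p`, and parallelizability.

Rank six implies flatness. The abelian system is of finite type: modulo its equations and their
derivatives of order at most two, the 3-jet of `(w, u, v)` is determined by `w₂₂, w₂, v₂, w, u, v`
(`jets_vanish`), because the third derivatives along `δ₂` satisfy a Vandermonde system with nodes
`1, a, b`, which are distinct and nonzero. So these six coordinates obey a total linear system,
solution germs embed in `ℝ⁶`, and the rank is at most six. The multi-bracket `ϰ` vanishes on
solutions. On the other hand `δ₁` and `δ₂` commute up to `K`, so the terms of `ϰ` of orders four and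
three cancel, and `bracket_reduce` leaves a linear form in the six coordinates with leading
coefficient `-10 (a - 1) (b - 1) K`. At rank six the solutions fill `ℝ⁶` at every point near `p`, so
this form is zero there and `K = 0`.

Flatness implies parallelizability. If `dγ = 0`, then locally `γ = df`, the forms `exp f • ω₁` and
`exp f • ω₂` are closed, and their primitives are coordinates in which all five forms, up to the
factor `exp f`, have constant coefficients.

Parallelizability implies rank six. For linear first integrals `tᵢ`, relations `∑ Pᵢ(tᵢ) dtᵢ = 0`
with quadratic `Pᵢ` amount to 9 linear equations for 15 coefficients.

The coefficients of the obstruction are unique because the six coordinates are free on the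
prolongation. This is a dimension count: triples of cubics have 30 coefficients, and the conditions
and coordinates number 24 + 6 (`jetMap_surjective`).

The algebra is done once in an abstract `WeightedCalculus`, followed by a ring homomorphism `π`.
Evaluation at a point gives statements about jets; the quotient by the ideal of the six coordinates
gives the total linear system. -/

noncomputable section

namespace PlanarWeb

/-! ## Covariant derivatives of weighted functions, algebraically -/

/-- A ring with the formal properties of the operators `δ₁, δ₂` on functions of each weight: they
are additive, satisfy the Leibniz rule, and commute up to the curvature `K`. -/
structure WeightedCalculus (A : Type*) [CommRing A] where
  /-- the operator `δ₁` or `δ₂` on functions of a given weight -/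
  D : Fin 2 → ℕ → A → A
  /-- the curvature -/
  K : A
  D_add : ∀ i k x y, D i k (x + y) = D i k x + D i k y
  D_mul : ∀ i k l x y, D i (k + l) (x * y) = D i k x * y + x * D i l y
  D_comm : ∀ (k : ℕ) x, D 1 (k + 1) (D 0 k x) = D 0 (k + 1) (D 1 k x) + k * (K * x)

namespace WeightedCalculus

variable {A : Type*} [CommRing A] (S : WeightedCalculus A)

/-- Constants of the calculus: the elements killed by both operators in weight zero. -/
def IsConst (c : A) : Prop := ∀ i, S.D i 0 c = 0

/-- The operator `δ₁ - δ₂ ∘ c`. -/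
def Δ (c : A) (k : ℕ) (x : A) : A := S.D 0 k x - S.D 1 k (c * x)

/-- The multi-bracket of the operators of the abelian system. -/
def bracket (a b w u v : A) : A :=
  (S.Δ 1 4 (S.Δ a 3 (S.Δ b 2 (S.D 0 1 w))) - S.D 0 4 (S.Δ a 3 (S.Δ b 2 (S.Δ 1 1 w)))) +
  (S.Δ 1 4 (S.Δ a 3 (S.Δ b 2 (S.D 0 1 u))) - S.Δ 1 4 (S.D 0 3 (S.Δ b 2 (S.Δ a 1 u)))) +
  (S.Δ 1 4 (S.Δ a 3 (S.Δ b 2 (S.D 0 1 v))) - S.Δ 1 4 (S.Δ a 3 (S.D 0 2 (S.Δ b 1 v))))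

variable {S}

theorem D_zero (i : Fin 2) (k : ℕ) : S.D i k 0 = 0 := by
  have h := S.D_add i k 0 0
  rw [add_zero] at h
  exact left_eq_add.mp h

theorem D_neg (i : Fin 2) (k : ℕ) (x : A) : S.D i k (-x) = -S.D i k x := by
  have h := S.D_add i k x (-x)
  rw [add_neg_cancel, D_zero] at h
  linear_combination -h

theorem D_sub (i : Fin 2) (k : ℕ) (x y : A) : S.D i k (x - y) = S.D i k x - S.D i k y := by
  rw [sub_eq_add_neg, S.D_add, D_neg, ← sub_eq_add_neg]

theorem IsConst.D_mul {c : A} (hc : S.IsConst c) (i : Fin 2) (k : ℕ) (x : A) :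
    S.D i k (c * x) = c * S.D i k x := by
  have h := S.D_mul i 0 k c x
  rwa [hc i, zero_mul, zero_add, zero_add] at h

theorem D_comm_one (x : A) : S.D 1 2 (S.D 0 1 x) = S.D 0 2 (S.D 1 1 x) + S.K * x := by
  have h := S.D_comm 1 x
  norm_num at h
  exact h

/-- The factor `k` is spread out as a repeated sum, so that a further operator passes through it by
additivity alone. -/
theorem D_comm_two (x : A) :
    S.D 1 3 (S.D 0 2 x) = S.D 0 3 (S.D 1 2 x) + (S.K * x + S.K * x) := by
  have h := S.D_comm 2 x
  norm_num at h
  linear_combination h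

theorem D_comm_three (x : A) :
    S.D 1 4 (S.D 0 3 x) = S.D 0 4 (S.D 1 3 x) + (S.K * x + S.K * x + S.K * x) := by
  have h := S.D_comm 3 x
  norm_num at h
  linear_combination h

/-- The Leibniz rule at literal weights, where rewriting cannot recover the splitting `k + l` from a
numeral. -/
theorem D_mul_two_one (i : Fin 2) (x y : A) :
    S.D i 3 (x * y) = S.D i 2 x * y + x * S.D i 1 y := S.D_mul i 2 1 x y

theorem D_mul_three_one (i : Fin 2) (x y : A) :
    S.D i 4 (x * y) = S.D i 3 x * y + x * S.D i 1 y := S.D_mul i 3 1 x y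

theorem D_mul_two_two (i : Fin 2) (x y : A) :
    S.D i 4 (x * y) = S.D i 2 x * y + x * S.D i 2 y := S.D_mul i 2 2 x y

/-- The left-hand sides of the four equations of the abelian system. -/
def system (S : WeightedCalculus A) (a b w u v : A) : Fin 4 → A :=
  ![S.Δ 1 1 w, S.Δ a 1 u, S.Δ b 1 v, S.D 0 1 w + S.D 0 1 u + S.D 0 1 v]

/-- The fibre coordinates `w₂₂, w₂, v₂, w, u, v` of the prolongation of the abelian system. -/
def coords (S : WeightedCalculus A) (w u v : A) : Fin 6 → A :=
  ![S.D 1 2 (S.D 1 1 w), S.D 1 1 w, S.D 1 1 v, w, u, v]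

theorem system_add (a b w u v w' u' v' : A) (j : Fin 4) :
    S.system a b (w + w') (u + u') (v + v') j = S.system a b w u v j + S.system a b w' u' v' j := by
  fin_cases j <;> simp only [system, Δ, mul_add, S.D_add, Fin.reduceFinMk, Matrix.cons_val] <;> ring

theorem system_const_mul (a b : A) {c : A} (hc : S.IsConst c) (w u v : A) (j : Fin 4) :
    S.system a b (c * w) (c * u) (c * v) j = c * S.system a b w u v j := by
  fin_cases j <;>
    simp only [system, Δ, hc.D_mul, mul_left_comm _ c, Fin.reduceFinMk, Matrix.cons_val] <;> ring

theorem coords_add (w u v w' u' v' : A) (j : Fin 6) :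
    S.coords (w + w') (u + u') (v + v') j = S.coords w u v j + S.coords w' u' v' j := by
  fin_cases j <;> simp only [coords, S.D_add, Fin.reduceFinMk, Matrix.cons_val]

theorem coords_const_mul {c : A} (hc : S.IsConst c) (w u v : A) (j : Fin 6) :
    S.coords (c * w) (c * u) (c * v) j = c * S.coords w u v j := by
  fin_cases j <;> simp only [coords, hc.D_mul, Fin.reduceFinMk, Matrix.cons_val]

theorem Δ_add (c : A) (k : ℕ) (x y : A) : S.Δ c k (x + y) = S.Δ c k x + S.Δ c k y := by
  simp only [Δ, mul_add, S.D_add]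
  ring

theorem Δ_zero (c : A) (k : ℕ) : S.Δ c k 0 = 0 := by
  simp only [Δ, mul_zero, D_zero, sub_zero]

/-- The multi-bracket vanishes on solutions of the abelian system. -/
theorem bracket_eq_zero {a b w u v : A} (h : ∀ j, S.system a b w u v j = 0) :
    S.bracket a b w u v = 0 := by
  have h0 : S.Δ 1 1 w = 0 := h 0
  have h1 : S.Δ a 1 u = 0 := h 1
  have h2 : S.Δ b 1 v = 0 := h 2
  have h3 : S.D 0 1 w + S.D 0 1 u + S.D 0 1 v = 0 := h 3
  -- In each subtracted term the innermost operator is an equation of the system. What remains is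
  -- `Δ₁Δ₂Δ₃` applied to the fourth equation.
  have e : S.Δ 1 4 (S.Δ a 3 (S.Δ b 2 (S.D 0 1 w + S.D 0 1 u + S.D 0 1 v))) = 0 := by
    simp only [h3, Δ_zero]
  simp only [Δ_add] at e
  simp only [bracket, h0, h1, h2, Δ_zero, D_zero, sub_zero]
  exact e

/-! ### Normal forms modulo the abelian system -/

section Reduction

variable {B : Type*} [CommRing B] {a b w u v : A} (ha : S.IsConst a) (hb : S.IsConst b)
  (π : A →+* B)

include ha hb

/-- The first three equations trade `δ₁` for a multiple of `δ₂`; the fourth then becomes `w₂ + a u₂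
+ b v₂ = 0`. Stating this after an arbitrary `π` covers both evaluation at a point and passage to a
quotient ring. -/
theorem reduce_first (h : ∀ j, π (S.system a b w u v j) = 0) :
    π (S.D 0 1 w) = π (S.D 1 1 w) ∧ π (S.D 0 1 u) = π a * π (S.D 1 1 u) ∧
    π (S.D 0 1 v) = π b * π (S.D 1 1 v) ∧
    π (S.D 1 1 w) + π a * π (S.D 1 1 u) + π b * π (S.D 1 1 v) = 0 := by
  have h0 := h 0
  have h1 := h 1
  have h2 := h 2
  have h3 := h 3
  simp only [system, Δ, one_mul, ha.D_mul, hb.D_mul, Matrix.cons_val, map_sub, map_add, map_mul]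
    at h0 h1 h2 h3
  refine ⟨?_, ?_, ?_, ?_⟩
  · linear_combination h0
  · linear_combination h1
  · linear_combination h2
  · linear_combination h3 - h0 - h1 - h2

/-- Differentiating `w₂ + a u₂ + b v₂ = 0` along `δ₂` and `δ₁` gives `w₂₂ + a u₂₂ + b v₂₂ = 0` and
`w₂₂ + a² u₂₂ + b² v₂₂ = K (w + a u + b v)`. The last two conclusions come from eliminating `v₂₂`
and `u₂₂` respectively; they stay undivided since `π` takes values in any commutative ring. -/
theorem reduce_second (h : ∀ i j, π (S.D i 2 (S.system a b w u v j)) = 0) :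
    π (S.D 0 2 (S.D 0 1 w)) = π (S.D 0 2 (S.D 1 1 w)) ∧
    π (S.D 0 2 (S.D 0 1 u)) = π a * π (S.D 0 2 (S.D 1 1 u)) ∧
    π (S.D 0 2 (S.D 0 1 v)) = π b * π (S.D 0 2 (S.D 1 1 v)) ∧
    π (S.D 0 2 (S.D 1 1 w)) = π (S.D 1 2 (S.D 1 1 w)) - π S.K * π w ∧
    π (S.D 0 2 (S.D 1 1 u)) = π a * π (S.D 1 2 (S.D 1 1 u)) - π S.K * π u ∧
    π (S.D 0 2 (S.D 1 1 v)) = π b * π (S.D 1 2 (S.D 1 1 v)) - π S.K * π v ∧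
    π a * (π a - π b) * π (S.D 1 2 (S.D 1 1 u)) = (π b - 1) * π (S.D 1 2 (S.D 1 1 w)) +
      π S.K * (π w + π a * π u + π b * π v) ∧
    π b * (π b - π a) * π (S.D 1 2 (S.D 1 1 v)) = (π a - 1) * π (S.D 1 2 (S.D 1 1 w)) +
      π S.K * (π w + π a * π u + π b * π v) := by
  have h00 := h 0 0
  have h01 := h 0 1
  have h02 := h 0 2
  have h03 := h 0 3
  have h10 := h 1 0
  have h11 := h 1 1
  have h12 := h 1 2
  have h13 := h 1 3
  simp only [system, Δ, one_mul, ha.D_mul, hb.D_mul, Matrix.cons_val, D_sub, S.D_add, D_comm_one,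
    map_sub, map_add, map_mul] at h00 h01 h02 h03 h10 h11 h12 h13
  refine ⟨?_, ?_, ?_, ?_, ?_, ?_, ?_, ?_⟩
  · linear_combination h00
  · linear_combination h01
  · linear_combination h02
  · linear_combination h10
  · linear_combination h11
  · linear_combination h12
  · linear_combination (h03 - h00 - h01 - h02) - π b * (h13 - h10 - h11 - h12) - h10 - π a * h11 -
      π b * h12
  · linear_combination (h03 - h00 - h01 - h02) - π a * (h13 - h10 - h11 - h12) - h10 - π a * h11 -
      π b * h12

/-- The multi-bracket restricted to the prolongation of the abelian system. -/
theorem bracket_reduce (h : ∀ j, π (S.system a b w u v j) = 0)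
    (h' : ∀ i j, π (S.D i 2 (S.system a b w u v j)) = 0) :
    π (S.bracket a b w u v) =
      -10 * (π a - 1) * (π b - 1) * π S.K * π (S.D 1 2 (S.D 1 1 w)) -
      5 * (π a - 1) * (π b * π (S.D 1 2 S.K) - π (S.D 0 2 S.K)) * π (S.D 1 1 w) -
      5 * π b * (π a - π b) * (π (S.D 1 2 S.K) - π (S.D 0 2 S.K)) * π (S.D 1 1 v) -
      (π (S.D 0 3 (S.D 0 2 S.K)) - (π a + π b) * (π (S.D 0 3 (S.D 1 2 S.K)) + π S.K ^ 2) +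
        π a * π b * π (S.D 1 3 (S.D 1 2 S.K)) + 5 * (π a + π b - 2) * π S.K ^ 2) * π w -
      π a * (π (S.D 0 3 (S.D 0 2 S.K)) - (π b + 1) * (π (S.D 0 3 (S.D 1 2 S.K)) + π S.K ^ 2) +
        π b * π (S.D 1 3 (S.D 1 2 S.K)) + 5 * (π b - 1) * π S.K ^ 2) * π u -
      π b * (π (S.D 0 3 (S.D 0 2 S.K)) - (π a + 1) * (π (S.D 0 3 (S.D 1 2 S.K)) + π S.K ^ 2) +
        π a * π (S.D 1 3 (S.D 1 2 S.K)) + 5 * (π a - 1) * π S.K ^ 2) * π v := by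
  have h1 := fun i (x : A) => D_mul_two_one (S := S) i S.K x
  have h2 := fun i j (x : A) => D_mul_three_one (S := S) i (S.D j 2 S.K) x
  have h3 := fun i j (x : A) => D_mul_two_two (S := S) i S.K (S.D j 1 x)
  have d1 : ∀ x, S.Δ 1 4 x = S.D 0 4 x - S.D 1 4 x := fun x => by simp [Δ]
  have d1' : ∀ x, S.Δ 1 1 x = S.D 0 1 x - S.D 1 1 x := fun x => by simp [Δ]
  obtain ⟨e1, e2, e3, e4⟩ := reduce_first ha hb π h
  obtain ⟨f1, f2, f3, f4, f5, f6, f7, f8⟩ := reduce_second ha hb π h'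
  -- An identity in `A`, before any equation is used. Once every mixed derivative is ordered with
  -- `δ₁` outside `δ₂`, the terms of orders four and three cancel, which is why first derivatives of
  -- the system suffice below.
  have key : S.bracket a b w u v =
      S.K * (-6 * a * b * S.D 1 2 (S.D 1 1 w) - 3 * a * b * S.D 1 2 (S.D 1 1 u)
        - a * b * S.D 1 2 (S.D 1 1 v) + 6 * (a + b) * S.D 0 2 (S.D 1 1 w)
        + 3 * a * (b + 1) * S.D 0 2 (S.D 1 1 u) + b * (a + 1) * S.D 0 2 (S.D 1 1 v)
        - 6 * S.D 0 2 (S.D 0 1 w) - 3 * a * S.D 0 2 (S.D 0 1 u) - b * S.D 0 2 (S.D 0 1 v))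
      + S.D 0 2 S.K * (3 * b * S.D 1 1 w + a * S.D 1 1 w - 4 * S.D 0 1 w
        + 3 * a * b * S.D 1 1 u + a * S.D 1 1 u - 4 * a * S.D 0 1 u
        + a * b * S.D 1 1 v + b * S.D 1 1 v - 2 * b * S.D 0 1 v)
      + S.D 1 2 S.K * (b * S.D 0 1 w + 3 * a * S.D 0 1 w - 4 * a * b * S.D 1 1 w
        + a * b * S.D 0 1 u + 3 * a * S.D 0 1 u - 4 * a * b * S.D 1 1 u
        + a * b * S.D 0 1 v + b * S.D 0 1 v - 2 * a * b * S.D 1 1 v)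
      - S.D 0 3 (S.D 0 2 S.K) * (w + a * u + b * v)
      + S.D 0 3 (S.D 1 2 S.K) * (a * w + b * w + a * u + a * b * u + b * v + a * b * v)
      - S.D 1 3 (S.D 1 2 S.K) * (a * b * (w + u + v))
      + S.K ^ 2 * (5 * a * w + 3 * b * w + 5 * a * u + 3 * b * v) := by
    simp only [bracket, d1, d1']
    simp only [Δ, D_sub, S.D_add, ha.D_mul, hb.D_mul, D_comm_one, D_comm_two, D_comm_three,
      h1, h2, h3]
    ring
  rw [key]
  simp only [map_add, map_sub, map_mul, map_pow, map_neg, map_ofNat, map_one]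
  rw [f1, f2, f3, f4, f5, f6, e1, e2, e3]
  -- `f7` and `f8` eliminate `u₂₂` and `v₂₂`, and `e4` eliminates `u₂`. The terms in `w₂₂`, `u₂₂`,
  -- `v₂₂` contribute 6, 3 and 1 to the factor 10.
  linear_combination 3 * π S.K * (π a - 1) * (-1) * f7 + π S.K * (π b - 1) * (-1) * f8 +
    (π (S.D 0 2 S.K) * (1 - 4 * π a + 3 * π b) +
      π (S.D 1 2 S.K) * (π a * π b + 3 * π a - 4 * π b)) * e4

end Reduction

/-- The image under `π` of the 3-jet of `x` vanishes. -/
structure JetVanishes (S : WeightedCalculus A) {B : Type*} [CommRing B] (π : A →+* B) (x : A) :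
    Prop where
  zero : π x = 0
  one : ∀ i, π (S.D i 1 x) = 0
  two : ∀ i j, π (S.D i 2 (S.D j 1 x)) = 0
  three : ∀ i j k, π (S.D i 3 (S.D j 2 (S.D k 1 x))) = 0

/-! ### Finite type of the abelian system -/

section Jets

variable {B : Type*} [CommRing B] (π : A →+* B)

/-- One ordering of each mixed derivative is enough: reordering adds only the curvature or its
derivatives times lower derivatives of `x`. -/
theorem JetVanishes.of_normal {x : A} (h : π x = 0) (h0 : π (S.D 0 1 x) = 0)
    (h1 : π (S.D 1 1 x) = 0) (h00 : π (S.D 0 2 (S.D 0 1 x)) = 0)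
    (h01 : π (S.D 0 2 (S.D 1 1 x)) = 0) (h11 : π (S.D 1 2 (S.D 1 1 x)) = 0)
    (h000 : π (S.D 0 3 (S.D 0 2 (S.D 0 1 x))) = 0) (h001 : π (S.D 0 3 (S.D 0 2 (S.D 1 1 x))) = 0)
    (h011 : π (S.D 0 3 (S.D 1 2 (S.D 1 1 x))) = 0) (h111 : π (S.D 1 3 (S.D 1 2 (S.D 1 1 x))) = 0) :
    S.JetVanishes π x := by
  refine ⟨h, ?_, ?_, ?_⟩
  · intro i
    fin_cases i <;> simp [h0, h1]
  · intro i j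
    fin_cases i <;> fin_cases j <;> simp [D_comm_one, h, h00, h01, h11]
  · intro i j k
    fin_cases i <;> fin_cases j <;> fin_cases k <;>
      simp [D_comm_one, D_comm_two, S.D_add, D_mul_two_one, h, h0, h1, h000, h001, h011, h111]

/-- The abelian system is of finite type: on its second prolongation the 3-jet of `(w, u, v)` is
determined by `w₂₂, w₂, v₂, w, u, v`. -/
theorem jets_vanish {a b w u v : A} (ha : S.IsConst a) (hb : S.IsConst b)
    (ha0 : IsUnit (π a)) (hb0 : IsUnit (π b)) (ha1 : IsUnit (π a - 1)) (hb1 : IsUnit (π b - 1))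
    (hab : IsUnit (π a - π b))
    (h0 : ∀ j, π (S.system a b w u v j) = 0)
    (h1 : ∀ i j, π (S.D i 2 (S.system a b w u v j)) = 0)
    (g0 : ∀ j, π (S.D 0 3 (S.D 0 2 (S.system a b w u v j))) = 0)
    (g1 : ∀ j, π (S.D 0 3 (S.D 1 2 (S.system a b w u v j))) = 0)
    (g2 : ∀ j, π (S.D 1 3 (S.D 1 2 (S.system a b w u v j))) = 0)
    (hc : ∀ i, π (S.coords w u v i) = 0) :
    S.JetVanishes π w ∧ S.JetVanishes π u ∧ S.JetVanishes π v := by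
  have hw22 : π (S.D 1 2 (S.D 1 1 w)) = 0 := hc 0
  have hw2 : π (S.D 1 1 w) = 0 := hc 1
  have hv2 : π (S.D 1 1 v) = 0 := hc 2
  have hw : π w = 0 := hc 3
  have hu : π u = 0 := hc 4
  have hv : π v = 0 := hc 5
  obtain ⟨e1, e2, e3, e4⟩ := reduce_first ha hb π h0
  obtain ⟨f1, f2, f3, f4, f5, f6, f7, f8⟩ := reduce_second ha hb π h1
  have hu2 : π (S.D 1 1 u) = 0 := by
    rw [hw2, hv2, zero_add, mul_zero, add_zero] at e4
    exact (ha0.mul_right_eq_zero).1 e4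
  have hu22 : π (S.D 1 2 (S.D 1 1 u)) = 0 := by
    rw [hw22, hw, hu, hv] at f7
    simp only [mul_zero, add_zero] at f7
    exact ((ha0.mul hab).mul_right_eq_zero).1 f7
  have hv22 : π (S.D 1 2 (S.D 1 1 v)) = 0 := by
    rw [hw22, hw, hu, hv] at f8
    simp only [mul_zero, add_zero] at f8
    refine ((hb0.mul ?_).mul_right_eq_zero).1 f8
    rw [← neg_sub]
    exact hab.neg
  have hw1 : π (S.D 0 1 w) = 0 := by rw [e1, hw2]
  have hu1 : π (S.D 0 1 u) = 0 := by rw [e2, hu2, mul_zero]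
  have hv1 : π (S.D 0 1 v) = 0 := by rw [e3, hv2, mul_zero]
  rw [hw22, hw] at f4
  rw [hu22, hu] at f5
  rw [hv22, hv] at f6
  simp only [mul_zero, sub_zero] at f4 f5 f6
  rw [f4] at f1
  rw [f5, mul_zero] at f2
  rw [f6, mul_zero] at f3
  have g00 := g0 0
  have g01 := g0 1
  have g02 := g0 2
  have g03 := g0 3
  have g10 := g1 0
  have g11 := g1 1
  have g12 := g1 2
  have g13 := g1 3
  have g20 := g2 0
  have g21 := g2 1
  have g22 := g2 2
  have g23 := g2 3
  simp only [system, Δ, one_mul, ha.D_mul, hb.D_mul, Matrix.cons_val, D_sub, S.D_add, D_comm_one,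
    D_comm_two, D_mul_two_one, map_sub, map_add, map_mul, hw, hu, hv, hw1, hu1, hv1, hw2, hu2, hv2,
    mul_zero, add_zero] at g00 g01 g02 g03 g10 g11 g12 g13 g20 g21 g22 g23
  set W := π (S.D 1 3 (S.D 1 2 (S.D 1 1 w)))
  set U := π (S.D 1 3 (S.D 1 2 (S.D 1 1 u)))
  set V := π (S.D 1 3 (S.D 1 2 (S.D 1 1 v)))
  -- Replacing each outer `δ₁` by `1`, `a` or `b` times `δ₂` turns the three second derivatives of
  -- the fourth equation into a Vandermonde system for the `δ₂³`-derivatives, with nodes `1, a, b`.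
  have r1 : W + π a * U + π b * V = 0 := by
    linear_combination g23 - g20 - g21 - g22
  have r2 : W + π a ^ 2 * U + π b ^ 2 * V = 0 := by
    linear_combination g13 - g10 - g11 - g12 - g20 - π a * g21 - π b * g22
  have r3 : W + π a ^ 3 * U + π b ^ 3 * V = 0 := by
    linear_combination g03 - g00 - g01 - g02 - g10 - π a * g11 - π b * g12 - g20 -
      π a ^ 2 * g21 - π b ^ 2 * g22
  have hU : U = 0 := by
    refine (((ha0.mul ha1).mul hab).mul_right_eq_zero).1 ?_
    linear_combination r3 - r2 - π b * (r2 - r1)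
  have hV : V = 0 := by
    refine (((hb0.mul hb1).mul hab).mul_right_eq_zero).1 ?_
    linear_combination π a * (r2 - r1) - (r3 - r2)
  have hW : W = 0 := by
    rw [hU, hV] at r1
    linear_combination r1
  rw [hW, sub_zero] at g20
  rw [hU, mul_zero, sub_zero] at g21
  rw [hV, mul_zero, sub_zero] at g22
  rw [g20, sub_zero] at g10
  rw [g21, mul_zero, sub_zero] at g11
  rw [g22, mul_zero, sub_zero] at g12
  rw [g10, sub_zero] at g00
  rw [g11, mul_zero, sub_zero] at g01
  rw [g12, mul_zero, sub_zero] at g02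
  exact ⟨.of_normal π hw hw1 hw2 f1 f4 hw22 g00 g10 g20 hW,
    .of_normal π hu hu1 hu2 f2 f5 hu22 g01 g11 g21 hU,
    .of_normal π hv hv1 hv2 f3 f6 hv22 g02 g12 g22 hV⟩

end Jets

end WeightedCalculus

/-! ## Calculus of 1-forms and functions on an open set -/

theorem contDiffOn_fderiv_apply {f : ℝ × ℝ → ℝ} {U : Set (ℝ × ℝ)} (hU : IsOpen U)
    (hf : ContDiffOn ℝ ∞ f U) {v : ℝ × ℝ → ℝ × ℝ} (hv : ContDiffOn ℝ ∞ v U) :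
    ContDiffOn ℝ ∞ (fun q => fderiv ℝ f q (v q)) U :=
  (hf.fderiv_of_isOpen hU (m := ∞) (by simp)).clm_apply hv

theorem contDiffOn_coeff {η : OneForm} {U : Set (ℝ × ℝ)} (h : ContDiffOn ℝ ∞ η U) (v : ℝ × ℝ) :
    ContDiffOn ℝ ∞ (fun q => η q v) U :=
  h.clm_apply contDiffOn_const

theorem contDiffOn_wedge {α β : OneForm} {U : Set (ℝ × ℝ)} (hα : ContDiffOn ℝ ∞ α U)
    (hβ : ContDiffOn ℝ ∞ β U) : ContDiffOn ℝ ∞ (wedge α β) U :=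
  ((contDiffOn_coeff hα _).mul (contDiffOn_coeff hβ _)).sub
    ((contDiffOn_coeff hα _).mul (contDiffOn_coeff hβ _))

theorem contDiffOn_dForm {η : OneForm} {U : Set (ℝ × ℝ)} (hU : IsOpen U)
    (h : ContDiffOn ℝ ∞ η U) : ContDiffOn ℝ ∞ (dForm η) U :=
  (contDiffOn_fderiv_apply hU (contDiffOn_coeff h _) contDiffOn_const).sub
    (contDiffOn_fderiv_apply hU (contDiffOn_coeff h _) contDiffOn_const)

theorem dForm_congr {η θ : OneForm} {U : Set (ℝ × ℝ)} (hU : IsOpen U) (h : Set.EqOn η θ U)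
    {q : ℝ × ℝ} (hq : q ∈ U) : dForm η q = dForm θ q := by
  have h' : η =ᶠ[𝓝 q] θ := h.eventuallyEq_of_mem (hU.mem_nhds hq)
  have e : ∀ v : ℝ × ℝ, (fun x => η x v) =ᶠ[𝓝 q] fun x => θ x v := fun v =>
    h'.mono fun x hx => by simp only [hx]
  simp only [dForm, (e _).fderiv_eq]

theorem dForm_add {η θ : OneForm} {U : Set (ℝ × ℝ)} (hU : IsOpen U)
    (hη : ContDiffOn ℝ ∞ η U) (hθ : ContDiffOn ℝ ∞ θ U) {q : ℝ × ℝ} (hq : q ∈ U) :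
    dForm (fun x => η x + θ x) q = dForm η q + dForm θ q := by
  simp only [dForm, add_apply]
  rw [fderiv_fun_add (differentiableAt_coeff hU hη hq _) (differentiableAt_coeff hU hθ hq _),
    fderiv_fun_add (differentiableAt_coeff hU hη hq _) (differentiableAt_coeff hU hθ hq _)]
  simp only [add_apply]
  ring

theorem dForm_smul {f : ℝ × ℝ → ℝ} {η : OneForm} {U : Set (ℝ × ℝ)} (hU : IsOpen U)
    (hf : ContDiffOn ℝ ∞ f U) (hη : ContDiffOn ℝ ∞ η U) {q : ℝ × ℝ} (hq : q ∈ U) :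
    dForm (fun x => f x • η x) q = wedge (fderiv ℝ f) η q + f q * dForm η q := by
  have hf' : DifferentiableAt ℝ f q := (hf.contDiffAt (hU.mem_nhds hq)).differentiableAt (by simp)
  simp only [dForm, wedge, smul_apply, smul_eq_mul]
  rw [fderiv_fun_mul hf' (differentiableAt_coeff hU hη hq _),
    fderiv_fun_mul hf' (differentiableAt_coeff hU hη hq _)]
  simp only [add_apply, smul_apply, smul_eq_mul]
  ring

theorem dForm_fderiv {f : ℝ × ℝ → ℝ} {U : Set (ℝ × ℝ)} (hU : IsOpen U)
    (hf : ContDiffOn ℝ ∞ f U) {q : ℝ × ℝ} (hq : q ∈ U) : dForm (fderiv ℝ f) q = 0 := by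
  have hf' : DifferentiableAt ℝ (fderiv ℝ f) q :=
    ((hf.fderiv_of_isOpen hU (m := ∞) (by simp)).contDiffAt (hU.mem_nhds hq)).differentiableAt
      (by simp)
  have hs : IsSymmSndFDerivAt ℝ f q :=
    (hf.contDiffAt (hU.mem_nhds hq)).isSymmSndFDerivAt (by
      rw [minSmoothness_of_isRCLikeNormedField]
      exact ENat.LEInfty.out)
  simp only [dForm]
  rw [fderiv_clm_apply hf' (differentiableAt_const _), fderiv_clm_apply hf' (differentiableAt_const _)]
  simpa using sub_eq_zero.2 (hs (1, 0) (0, 1))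

theorem clm_eq_of_coeffs {α β : ℝ × ℝ →L[ℝ] ℝ} (h1 : α (1, 0) = β (1, 0))
    (h2 : α (0, 1) = β (0, 1)) : α = β := by
  ext <;> simp [h1, h2]

/-! ## Coframes -/

/-- `ω₁, ω₂` is a smooth basis of 1-forms on the open set `U`. -/
structure IsCoframe (U : Set (ℝ × ℝ)) (ω₁ ω₂ : OneForm) : Prop where
  isOpen : IsOpen U
  smooth_one : ContDiffOn ℝ ∞ ω₁ U
  smooth_two : ContDiffOn ℝ ∞ ω₂ U
  wedge_ne_zero : ∀ q ∈ U, wedge ω₁ ω₂ q ≠ 0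

namespace IsCoframe

variable {U : Set (ℝ × ℝ)} {ω₁ ω₂ : OneForm} (h : IsCoframe U ω₁ ω₂)

include h

theorem mono {V : Set (ℝ × ℝ)} (hV : IsOpen V) (hVU : V ⊆ U) : IsCoframe V ω₁ ω₂ :=
  ⟨hV, h.smooth_one.mono hVU, h.smooth_two.mono hVU, fun q hq => h.wedge_ne_zero q (hVU hq)⟩

theorem smooth_frame (i : Fin 2) : ContDiffOn ℝ ∞ (frame ω₁ ω₂ i) U := by
  refine ((contDiffOn_wedge h.smooth_one h.smooth_two).inv h.wedge_ne_zero).smul ?_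
  fin_cases i
  · exact (contDiffOn_coeff h.smooth_two (0, 1)).prodMk (contDiffOn_coeff h.smooth_two (1, 0)).neg
  · exact (contDiffOn_coeff h.smooth_one (0, 1)).neg.prodMk (contDiffOn_coeff h.smooth_one (1, 0))

theorem smooth_connCoeff (i : Fin 2) : ContDiffOn ℝ ∞ (connCoeff ω₁ ω₂ i) U := by
  have hw := contDiffOn_wedge h.smooth_one h.smooth_two
  fin_cases i
  · exact ((contDiffOn_dForm h.isOpen h.smooth_two).div hw h.wedge_ne_zero).neg
  · exact (contDiffOn_dForm h.isOpen h.smooth_one).div hw h.wedge_ne_zero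

theorem smooth_connForm : ContDiffOn ℝ ∞ (connForm ω₁ ω₂) U :=
  ((h.smooth_connCoeff 0).smul h.smooth_one).add ((h.smooth_connCoeff 1).smul h.smooth_two)

theorem smooth_curvature : ContDiffOn ℝ ∞ (curvature ω₁ ω₂) U :=
  (contDiffOn_dForm h.isOpen h.smooth_connForm).div
    (contDiffOn_wedge h.smooth_one h.smooth_two) h.wedge_ne_zero

theorem smooth_covD {f : ℝ × ℝ → ℝ} (hf : ContDiffOn ℝ ∞ f U) (i : Fin 2) (k : ℕ) :
    ContDiffOn ℝ ∞ (covD ω₁ ω₂ i k f) U :=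
  (contDiffOn_fderiv_apply h.isOpen hf (h.smooth_frame i)).sub
    ((contDiffOn_const.mul (h.smooth_connCoeff i)).mul hf)

theorem differentiableAt {f : ℝ × ℝ → ℝ} (hf : ContDiffOn ℝ ∞ f U) {q : ℝ × ℝ} (hq : q ∈ U) :
    DifferentiableAt ℝ f q :=
  (hf.contDiffAt (h.isOpen.mem_nhds hq)).differentiableAt (by simp)

/-- Covariant derivatives are local and `U` is open, so the values of a function off `U` are
irrelevant. This makes the operators on `SmoothFn U` independent of the chosen extension. -/
theorem covD_congr {f g : ℝ × ℝ → ℝ} (hfg : Set.EqOn f g U) (i : Fin 2) (k : ℕ) :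
    Set.EqOn (covD ω₁ ω₂ i k f) (covD ω₁ ω₂ i k g) U := by
  intro q hq
  simp only [covD, hfg hq, (hfg.eventuallyEq_of_mem (h.isOpen.mem_nhds hq)).fderiv_eq]

theorem covD_add {f g : ℝ × ℝ → ℝ} (hf : ContDiffOn ℝ ∞ f U) (hg : ContDiffOn ℝ ∞ g U)
    (i : Fin 2) (k : ℕ) {q : ℝ × ℝ} (hq : q ∈ U) :
    covD ω₁ ω₂ i k (fun x => f x + g x) q = covD ω₁ ω₂ i k f q + covD ω₁ ω₂ i k g q := by
  simp only [covD]
  rw [fderiv_fun_add (h.differentiableAt hf hq) (h.differentiableAt hg hq)]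
  simp only [add_apply]
  ring

theorem covD_mul {f g : ℝ × ℝ → ℝ} (hf : ContDiffOn ℝ ∞ f U) (hg : ContDiffOn ℝ ∞ g U)
    (i : Fin 2) (k l : ℕ) {q : ℝ × ℝ} (hq : q ∈ U) :
    covD ω₁ ω₂ i (k + l) (fun x => f x * g x) q =
      covD ω₁ ω₂ i k f q * g q + f q * covD ω₁ ω₂ i l g q := by
  simp only [covD]
  rw [fderiv_fun_mul (h.differentiableAt hf hq) (h.differentiableAt hg hq)]
  simp only [add_apply, smul_apply, smul_eq_mul]
  push_cast
  ring

omit h in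
theorem covD_eq (i : Fin 2) (k : ℕ) (f : ℝ × ℝ → ℝ) (q : ℝ × ℝ) :
    covD ω₁ ω₂ i k f q = covD ω₁ ω₂ i 0 f q - k * connCoeff ω₁ ω₂ i q * f q := by
  simp [covD]

theorem wedge_one (α : OneForm) {q : ℝ × ℝ} (hq : q ∈ U) :
    wedge α ω₁ q = -α q (frame ω₁ ω₂ 1 q) * wedge ω₁ ω₂ q := by
  have hw := h.wedge_ne_zero q hq
  have e : frame ω₁ ω₂ 1 q = (-(wedge ω₁ ω₂ q)⁻¹ * ω₁ q (0, 1)) • ((1 : ℝ), (0 : ℝ)) +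
      ((wedge ω₁ ω₂ q)⁻¹ * ω₁ q (1, 0)) • ((0 : ℝ), (1 : ℝ)) := by
    simp [frame]
  rw [e, map_add, map_smul, map_smul]
  have e' : wedge α ω₁ q = α q (1, 0) * ω₁ q (0, 1) - α q (0, 1) * ω₁ q (1, 0) := rfl
  rw [e', smul_eq_mul, smul_eq_mul]
  field_simp
  ring

theorem wedge_two (α : OneForm) {q : ℝ × ℝ} (hq : q ∈ U) :
    wedge α ω₂ q = α q (frame ω₁ ω₂ 0 q) * wedge ω₁ ω₂ q := by
  have hw := h.wedge_ne_zero q hq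
  have e : frame ω₁ ω₂ 0 q = ((wedge ω₁ ω₂ q)⁻¹ * ω₂ q (0, 1)) • ((1 : ℝ), (0 : ℝ)) +
      (-(wedge ω₁ ω₂ q)⁻¹ * ω₂ q (1, 0)) • ((0 : ℝ), (1 : ℝ)) := by
    simp [frame]
  rw [e, map_add, map_smul, map_smul]
  have e' : wedge α ω₂ q = α q (1, 0) * ω₂ q (0, 1) - α q (0, 1) * ω₂ q (1, 0) := rfl
  rw [e', smul_eq_mul, smul_eq_mul]
  field_simp
  ring

theorem form_eq (α : OneForm) {q : ℝ × ℝ} (hq : q ∈ U) :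
    α q = α q (frame ω₁ ω₂ 0 q) • ω₁ q + α q (frame ω₁ ω₂ 1 q) • ω₂ q := by
  have hw := h.wedge_ne_zero q hq
  have h1 := h.wedge_one α hq
  have h2 := h.wedge_two α hq
  have e0 : α q (frame ω₁ ω₂ 0 q) = wedge α ω₂ q / wedge ω₁ ω₂ q := by
    rw [h2, mul_div_assoc, div_self hw, mul_one]
  have e1 : α q (frame ω₁ ω₂ 1 q) = -(wedge α ω₁ q / wedge ω₁ ω₂ q) := by
    rw [h1, mul_div_assoc, div_self hw, mul_one, neg_neg]
  rw [e0, e1]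
  apply clm_eq_of_coeffs <;> simp only [add_apply, smul_apply, smul_eq_mul] <;> field_simp <;>
    simp only [wedge] <;> ring

theorem dForm_one {q : ℝ × ℝ} (hq : q ∈ U) :
    dForm ω₁ q = connCoeff ω₁ ω₂ 1 q * wedge ω₁ ω₂ q := by
  have hw := h.wedge_ne_zero q hq
  simp [connCoeff, hw]

theorem dForm_two {q : ℝ × ℝ} (hq : q ∈ U) :
    dForm ω₂ q = -connCoeff ω₁ ω₂ 0 q * wedge ω₁ ω₂ q := by
  have hw := h.wedge_ne_zero q hq
  simp [connCoeff, hw]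

theorem dForm_smul_one {f : ℝ × ℝ → ℝ} (hf : ContDiffOn ℝ ∞ f U) {q : ℝ × ℝ} (hq : q ∈ U) :
    dForm (fun x => f x • ω₁ x) q = -covD ω₁ ω₂ 1 1 f q * wedge ω₁ ω₂ q := by
  rw [dForm_smul h.isOpen hf h.smooth_one hq, h.wedge_one _ hq, h.dForm_one hq, covD]
  push_cast
  ring

theorem dForm_smul_two {f : ℝ × ℝ → ℝ} (hf : ContDiffOn ℝ ∞ f U) {q : ℝ × ℝ} (hq : q ∈ U) :
    dForm (fun x => f x • ω₂ x) q = covD ω₁ ω₂ 0 1 f q * wedge ω₁ ω₂ q := by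
  rw [dForm_smul h.isOpen hf h.smooth_two hq, h.wedge_two _ hq, h.dForm_two hq, covD]
  push_cast
  ring

theorem curvature_eq {q : ℝ × ℝ} (hq : q ∈ U) :
    curvature ω₁ ω₂ q = covD ω₁ ω₂ 0 0 (connCoeff ω₁ ω₂ 1) q -
      covD ω₁ ω₂ 1 0 (connCoeff ω₁ ω₂ 0) q := by
  have hw := h.wedge_ne_zero q hq
  have e : dForm (connForm ω₁ ω₂) q = dForm (fun x => connCoeff ω₁ ω₂ 0 x • ω₁ x) q +
      dForm (fun x => connCoeff ω₁ ω₂ 1 x • ω₂ x) q := dForm_add h.isOpen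
    ((h.smooth_connCoeff 0).smul h.smooth_one) ((h.smooth_connCoeff 1).smul h.smooth_two) hq
  rw [curvature, e, h.dForm_smul_one (h.smooth_connCoeff 0) hq,
    h.dForm_smul_two (h.smooth_connCoeff 1) hq, covD_eq 1 1, covD_eq 0 1]
  field_simp
  ring

/-- This is `d(df) = 0` for `df = ∂₁f ω₁ + ∂₂f ω₂`, with `dω₁` and `dω₂` expressed through `g₂` and
`g₁`. -/
theorem covD_zero_comm {f : ℝ × ℝ → ℝ} (hf : ContDiffOn ℝ ∞ f U) {q : ℝ × ℝ} (hq : q ∈ U) :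
    covD ω₁ ω₂ 0 0 (covD ω₁ ω₂ 1 0 f) q - covD ω₁ ω₂ 1 0 (covD ω₁ ω₂ 0 0 f) q =
      connCoeff ω₁ ω₂ 0 q * covD ω₁ ω₂ 1 0 f q - connCoeff ω₁ ω₂ 1 q * covD ω₁ ω₂ 0 0 f q := by
  have hw := h.wedge_ne_zero q hq
  have h0 := h.smooth_covD hf 0 0
  have h1 := h.smooth_covD hf 1 0
  have e := dForm_fderiv h.isOpen hf hq
  have e0 : dForm (fun x => covD ω₁ ω₂ 0 0 f x • ω₁ x + covD ω₁ ω₂ 1 0 f x • ω₂ x) q =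
      dForm (fun x => covD ω₁ ω₂ 0 0 f x • ω₁ x) q + dForm (fun x => covD ω₁ ω₂ 1 0 f x • ω₂ x) q :=
    dForm_add h.isOpen (h0.smul h.smooth_one) (h1.smul h.smooth_two) hq
  rw [dForm_congr h.isOpen (θ := fun x => covD ω₁ ω₂ 0 0 f x • ω₁ x + covD ω₁ ω₂ 1 0 f x • ω₂ x)
    (fun x hx => by simpa [covD] using h.form_eq (fderiv ℝ f) hx) hq,
    e0, h.dForm_smul_one h0 hq, h.dForm_smul_two h1 hq, ← add_mul] at e
  have e' := (mul_eq_zero.1 e).resolve_right hw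
  rw [covD_eq 1 1, covD_eq 0 1] at e'
  push_cast at e'
  linear_combination e'

/-- Expanding both sides in weight zero leaves the commutator of `∂₁, ∂₂`, absorbed by the shift of
weight from `k` to `k + 1`, and `k f (∂₁g₂ - ∂₂g₁)`, which is `k K f` by `curvature_eq`. -/
theorem covD_comm {f : ℝ × ℝ → ℝ} (hf : ContDiffOn ℝ ∞ f U) (k : ℕ) {q : ℝ × ℝ} (hq : q ∈ U) :
    covD ω₁ ω₂ 1 (k + 1) (covD ω₁ ω₂ 0 k f) q =
      covD ω₁ ω₂ 0 (k + 1) (covD ω₁ ω₂ 1 k f) q + k * (curvature ω₁ ω₂ q * f q) := by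
  have key : ∀ i j : Fin 2, covD ω₁ ω₂ i 0 (covD ω₁ ω₂ j k f) q =
      covD ω₁ ω₂ i 0 (covD ω₁ ω₂ j 0 f) q - k * (covD ω₁ ω₂ i 0 (connCoeff ω₁ ω₂ j) q * f q +
        connCoeff ω₁ ω₂ j q * covD ω₁ ω₂ i 0 f q) := by
    intro i j
    have e1 : Set.EqOn (covD ω₁ ω₂ j k f)
        (fun x => covD ω₁ ω₂ j 0 f x + (-k : ℝ) * (connCoeff ω₁ ω₂ j x * f x)) U := fun x _ => by
      simp only []
      rw [covD_eq j k]
      ring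
    have hp : ContDiffOn ℝ ∞ (fun x => connCoeff ω₁ ω₂ j x * f x) U := (h.smooth_connCoeff j).mul hf
    rw [h.covD_congr e1 i 0 hq, h.covD_add (h.smooth_covD hf j 0) (contDiffOn_const.mul hp) i 0 hq]
    have e2 := h.covD_mul (f := fun _ => (-k : ℝ)) contDiffOn_const hp i 0 0 hq
    have e3 := h.covD_mul (h.smooth_connCoeff j) hf i 0 0 hq
    have e4 : covD ω₁ ω₂ i 0 (fun _ => (-k : ℝ)) q = 0 := by simp [covD]
    rw [zero_add] at e2 e3
    rw [e2, e3, e4]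
    ring
  rw [covD_eq 1 (k + 1), covD_eq 0 (k + 1), key, key, covD_eq 0 k, covD_eq 1 k, h.curvature_eq hq]
  push_cast
  linear_combination -h.covD_zero_comm hf hq

end IsCoframe

/-! ## The ring of smooth functions on an open set -/

/-- The algebra of smooth functions on `U`. -/
def SmoothFn (U : Set (ℝ × ℝ)) : Subring (U → ℝ) where
  -- Elements are functions on the subtype, so equality is equality on `U`, while an extension to
  -- the plane is available for differentiation.
  carrier := {f | ∃ F : ℝ × ℝ → ℝ, ContDiffOn ℝ ∞ F U ∧ ∀ x : U, F x = f x}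
  zero_mem' := ⟨fun _ => 0, contDiffOn_const, fun _ => rfl⟩
  one_mem' := ⟨fun _ => 1, contDiffOn_const, fun _ => rfl⟩
  add_mem' := by
    rintro f g ⟨F, hF, hFf⟩ ⟨G, hG, hGg⟩
    exact ⟨fun x => F x + G x, hF.add hG, fun x => by simp [hFf, hGg]⟩
  mul_mem' := by
    rintro f g ⟨F, hF, hFf⟩ ⟨G, hG, hGg⟩
    exact ⟨fun x => F x * G x, hF.mul hG, fun x => by simp [hFf, hGg]⟩
  neg_mem' := by
    rintro f ⟨F, hF, hFf⟩
    exact ⟨fun x => -F x, hF.neg, fun x => by simp [hFf]⟩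

namespace SmoothFn

variable {U : Set (ℝ × ℝ)}

/-- The restriction to `U` of a function that is smooth on `U`. -/
def mk (F : ℝ × ℝ → ℝ) (hF : ContDiffOn ℝ ∞ F U) : SmoothFn U := ⟨fun x => F x, F, hF, fun _ => rfl⟩

/-- An extension of `f` to the plane. -/
def rep (f : SmoothFn U) : ℝ × ℝ → ℝ := f.2.choose

theorem smooth_rep (f : SmoothFn U) : ContDiffOn ℝ ∞ (SmoothFn.rep f) U := f.2.choose_spec.1

theorem rep_apply (f : SmoothFn U) (x : U) : (SmoothFn.rep f) x = f.1 x := f.2.choose_spec.2 x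

theorem rep_mk {F : ℝ × ℝ → ℝ} (hF : ContDiffOn ℝ ∞ F U) : Set.EqOn (SmoothFn.rep (mk F hF)) F U :=
  fun x hx => rep_apply (mk F hF) ⟨x, hx⟩

theorem rep_add (f g : SmoothFn U) : Set.EqOn (SmoothFn.rep (f + g)) (fun x => (SmoothFn.rep f) x + (SmoothFn.rep g) x) U := by
  intro x hx
  have h1 := rep_apply f ⟨x, hx⟩
  have h2 := rep_apply g ⟨x, hx⟩
  have h3 := rep_apply (f + g) ⟨x, hx⟩
  simp only [] at h1 h2 h3 ⊢
  rw [h1, h2, h3]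
  rfl

theorem rep_mul (f g : SmoothFn U) : Set.EqOn (SmoothFn.rep (f * g)) (fun x => (SmoothFn.rep f) x * (SmoothFn.rep g) x) U := by
  intro x hx
  have h1 := rep_apply f ⟨x, hx⟩
  have h2 := rep_apply g ⟨x, hx⟩
  have h3 := rep_apply (f * g) ⟨x, hx⟩
  simp only [] at h1 h2 h3 ⊢
  rw [h1, h2, h3]
  rfl

/-- A constant function. -/
def const (U : Set (ℝ × ℝ)) (c : ℝ) : SmoothFn U := mk (fun _ => c) contDiffOn_const

theorem rep_const (c : ℝ) : Set.EqOn (SmoothFn.rep (const U c)) (fun _ => c) U := rep_mk _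

/-- Evaluation at a point of `U`. -/
def eval {q : ℝ × ℝ} (hq : q ∈ U) : SmoothFn U →+* ℝ :=
  (Pi.evalRingHom (fun _ : U => ℝ) ⟨q, hq⟩).comp (SmoothFn U).subtype

theorem eval_eq {q : ℝ × ℝ} (hq : q ∈ U) (f : SmoothFn U) : eval hq f = (SmoothFn.rep f) q :=
  (rep_apply f ⟨q, hq⟩).symm

@[simp] theorem eval_mk {q : ℝ × ℝ} (hq : q ∈ U) {F : ℝ × ℝ → ℝ} (hF : ContDiffOn ℝ ∞ F U) :
    eval hq (mk F hF) = F q := rfl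

@[simp] theorem eval_const {q : ℝ × ℝ} (hq : q ∈ U) (c : ℝ) : eval hq (const U c) = c := rfl

theorem isUnit_map_const {B : Type*} [CommRing B] (π : SmoothFn U →+* B) {c : ℝ} (hc : c ≠ 0) :
    IsUnit (π (const U c)) := by
  refine IsUnit.map π (IsUnit.of_mul_eq_one (const U c⁻¹) (Subtype.ext (funext fun x => ?_)))
  exact mul_inv_cancel₀ hc

theorem const_sub (c d : ℝ) : const U (c - d) = const U c - const U d := rfl

theorem const_one : const U 1 = 1 := rfl

end SmoothFn

/-! ### Smooth functions as a weighted calculus -/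

namespace IsCoframe

variable {U : Set (ℝ × ℝ)} {ω₁ ω₂ : OneForm} (h : IsCoframe U ω₁ ω₂)

/-- The covariant derivatives on smooth functions on `U` as a weighted calculus. -/
def calculus : WeightedCalculus (SmoothFn U) where
  D i k f := SmoothFn.mk (covD ω₁ ω₂ i k (SmoothFn.rep f)) (h.smooth_covD (SmoothFn.smooth_rep f) i k)
  K := SmoothFn.mk (curvature ω₁ ω₂) h.smooth_curvature
  D_add i k f g := by
    refine Subtype.ext (funext fun x => ?_)
    exact (h.covD_congr (SmoothFn.rep_add f g) i k x.2).trans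
      (h.covD_add (SmoothFn.smooth_rep f) (SmoothFn.smooth_rep g) i k x.2)
  D_mul i k l f g := by
    refine Subtype.ext (funext fun x => ?_)
    refine (h.covD_congr (SmoothFn.rep_mul f g) i (k + l) x.2).trans
      ((h.covD_mul (SmoothFn.smooth_rep f) (SmoothFn.smooth_rep g) i k l x.2).trans ?_)
    rw [SmoothFn.rep_apply f, SmoothFn.rep_apply g]
    rfl
  D_comm k f := by
    refine Subtype.ext (funext fun x => ?_)
    refine (h.covD_congr (SmoothFn.rep_mk _) 1 (k + 1) x.2).trans
      ((h.covD_comm (SmoothFn.smooth_rep f) k x.2).trans ?_)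
    rw [SmoothFn.rep_apply f, ← h.covD_congr (SmoothFn.rep_mk (h.smooth_covD (SmoothFn.smooth_rep f) 1 k)) 0 (k + 1) x.2]
    have e : ((k : SmoothFn U) : U → ℝ) x = (k : ℝ) := by simp
    rw [← e]
    rfl

theorem isConst_const (c : ℝ) : h.calculus.IsConst (SmoothFn.const U c) := by
  intro i
  refine Subtype.ext (funext fun x => ?_)
  refine (h.covD_congr (SmoothFn.rep_const c) i 0 x.2).trans ?_
  simp [covD]

theorem D_mk {F : ℝ × ℝ → ℝ} (hF : ContDiffOn ℝ ∞ F U) (i : Fin 2) (k : ℕ) :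
    h.calculus.D i k (SmoothFn.mk F hF) =
      SmoothFn.mk (covD ω₁ ω₂ i k F) (h.smooth_covD hF i k) :=
  Subtype.ext (funext fun x => h.covD_congr (SmoothFn.rep_mk hF) i k x.2)

include h

theorem smooth_Delta (c : ℝ) {F : ℝ × ℝ → ℝ} (hF : ContDiffOn ℝ ∞ F U) (k : ℕ) :
    ContDiffOn ℝ ∞ (Delta ω₁ ω₂ (fun _ => c) k F) U :=
  (h.smooth_covD hF 0 k).sub (h.smooth_covD (contDiffOn_const.mul hF) 1 k)

theorem Delta_mk (c : ℝ) {F : ℝ × ℝ → ℝ} (hF : ContDiffOn ℝ ∞ F U) (k : ℕ) :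
    h.calculus.Δ (SmoothFn.const U c) k (SmoothFn.mk F hF) =
      SmoothFn.mk (Delta ω₁ ω₂ (fun _ => c) k F) (h.smooth_Delta c hF k) := by
  have e : SmoothFn.const U c * SmoothFn.mk F hF =
    SmoothFn.mk (fun q => c * F q) (contDiffOn_const.mul hF) := rfl
  rw [WeightedCalculus.Δ, e, h.D_mk, h.D_mk]
  rfl

theorem smooth_abelianSystem (a b : ℝ) {w u v : ℝ × ℝ → ℝ} (hw : ContDiffOn ℝ ∞ w U)
    (hu : ContDiffOn ℝ ∞ u U) (hv : ContDiffOn ℝ ∞ v U) (j : Fin 4) :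
    ContDiffOn ℝ ∞ (abelianSystem ω₁ ω₂ (fun _ => a) (fun _ => b) w u v j) U := by
  fin_cases j
  · exact h.smooth_Delta 1 hw 1
  · exact h.smooth_Delta a hu 1
  · exact h.smooth_Delta b hv 1
  · exact ((h.smooth_covD hw 0 1).add (h.smooth_covD hu 0 1)).add (h.smooth_covD hv 0 1)

theorem system_mk (a b : ℝ) {w u v : ℝ × ℝ → ℝ} (hw : ContDiffOn ℝ ∞ w U)
    (hu : ContDiffOn ℝ ∞ u U) (hv : ContDiffOn ℝ ∞ v U) (j : Fin 4) :
    h.calculus.system (SmoothFn.const U a) (SmoothFn.const U b) (SmoothFn.mk w hw)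
        (SmoothFn.mk u hu) (SmoothFn.mk v hv) j =
      SmoothFn.mk (abelianSystem ω₁ ω₂ (fun _ => a) (fun _ => b) w u v j)
        (h.smooth_abelianSystem a b hw hu hv j) := by
  fin_cases j
  · exact h.Delta_mk 1 hw 1
  · exact h.Delta_mk a hu 1
  · exact h.Delta_mk b hv 1
  · simp only [WeightedCalculus.system, Fin.reduceFinMk, Matrix.cons_val, h.D_mk]
    rfl

theorem kappa_eq (a b : ℝ) {w u v : ℝ × ℝ → ℝ} (hw : ContDiffOn ℝ ∞ w U)
    (hu : ContDiffOn ℝ ∞ u U) (hv : ContDiffOn ℝ ∞ v U) {q : ℝ × ℝ} (hq : q ∈ U) :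
    kappa ω₁ ω₂ (fun _ => a) (fun _ => b) w u v q =
      SmoothFn.eval hq (h.calculus.bracket (SmoothFn.const U a) (SmoothFn.const U b)
        (SmoothFn.mk w hw) (SmoothFn.mk u hu) (SmoothFn.mk v hv)) := by
  simp only [WeightedCalculus.bracket, ← SmoothFn.const_one (U := U), h.Delta_mk, h.D_mk]
  rfl

end IsCoframe

/-! ## Vanishing of jets -/

/-- All derivatives of `f` of order less than `n` vanish at `q`. -/
def VanishesTo {F : Type*} [NormedAddCommGroup F] [NormedSpace ℝ F] (n : ℕ) (f : ℝ × ℝ → F)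
    (q : ℝ × ℝ) : Prop :=
  ∀ k < n, iteratedFDeriv ℝ k f q = 0

namespace VanishesTo

variable {F : Type*} [NormedAddCommGroup F] [NormedSpace ℝ F] {U : Set (ℝ × ℝ)} {q : ℝ × ℝ} {n : ℕ}

theorem succ_iff {f : ℝ × ℝ → F} :
    VanishesTo (n + 1) f q ↔ f q = 0 ∧ VanishesTo n (fderiv ℝ f) q := by
  have e : ∀ k, iteratedFDeriv ℝ k (fderiv ℝ f) q = 0 ↔ iteratedFDeriv ℝ (k + 1) f q = 0 := by
    intro k
    rw [← norm_eq_zero, norm_iteratedFDeriv_fderiv, norm_eq_zero]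
  have e0 : iteratedFDeriv ℝ 0 f q = 0 ↔ f q = 0 := by
    rw [← norm_eq_zero, norm_iteratedFDeriv_zero, norm_eq_zero]
  constructor
  · intro h
    exact ⟨e0.1 (h 0 n.succ_pos), fun k hk => (e k).2 (h (k + 1) (by omega))⟩
  · rintro ⟨h0, h⟩ k hk
    rcases k with _ | k
    · exact e0.2 h0
    · exact (e k).1 (h k (by omega))

theorem of_le {m : ℕ} {f : ℝ × ℝ → F} (h : VanishesTo n f q) (hm : m ≤ n) : VanishesTo m f q :=
  fun k hk => h k (hk.trans_le hm)

theorem congr {f g : ℝ × ℝ → F} (hU : IsOpen U) (hq : q ∈ U) (hfg : Set.EqOn f g U)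
    (h : VanishesTo n f q) : VanishesTo n g q := by
  intro k hk
  rw [← h k hk]
  exact (((hfg.eventuallyEq_of_mem (hU.mem_nhds hq)).iteratedFDeriv ℝ k).eq_of_nhds).symm

theorem add {f g : ℝ × ℝ → F} (hU : IsOpen U) (hq : q ∈ U) (hf : ContDiffOn ℝ ∞ f U)
    (hg : ContDiffOn ℝ ∞ g U) (h : VanishesTo n f q) (h' : VanishesTo n g q) :
    VanishesTo n (fun x => f x + g x) q := by
  intro k hk
  have hk' : (k : WithTop ℕ∞) ≤ ∞ := mod_cast le_top
  have e := iteratedFDerivWithin_add_apply (𝕜 := ℝ) (i := k) ((hf q hq).of_le hk')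
    ((hg q hq).of_le hk') hU.uniqueDiffOn hq
  rw [iteratedFDerivWithin_of_isOpen k hU hq, iteratedFDerivWithin_of_isOpen k hU hq,
    iteratedFDerivWithin_of_isOpen k hU hq, h k hk, h' k hk, add_zero] at e
  exact e

/-- In the Leibniz estimate every summand contains a derivative of `f` of order less than `n`, so
nothing is asked of `g` beyond smoothness. -/
theorem smul {f : ℝ × ℝ → ℝ} {g : ℝ × ℝ → F} (hU : IsOpen U) (hq : q ∈ U)
    (hf : ContDiffOn ℝ ∞ f U) (hg : ContDiffOn ℝ ∞ g U) (h : VanishesTo n f q) :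
    VanishesTo n (fun x => f x • g x) q := by
  intro k hk
  have hk' : (k : WithTop ℕ∞) ≤ ∞ := mod_cast le_top
  have e := norm_iteratedFDerivWithin_smul_le hf hg hU.uniqueDiffOn hq hk'
  rw [iteratedFDerivWithin_of_isOpen k hU hq, Finset.sum_eq_zero] at e
  · exact norm_le_zero_iff.1 e
  · intro i hi
    rw [iteratedFDerivWithin_of_isOpen i hU hq, h i (by simp at hi; omega)]
    simp

theorem apply {α : OneForm} {v : ℝ × ℝ → ℝ × ℝ} (hU : IsOpen U) (hq : q ∈ U)
    (hf : ContDiffOn ℝ ∞ α U) (hg : ContDiffOn ℝ ∞ v U) (h : VanishesTo n α q) :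
    VanishesTo n (fun x => α x (v x)) q := by
  intro k hk
  have hk' : (k : WithTop ℕ∞) ≤ ∞ := mod_cast le_top
  have e := norm_iteratedFDerivWithin_clm_apply hf hg hU.uniqueDiffOn hq hk'
  rw [iteratedFDerivWithin_of_isOpen k hU hq, Finset.sum_eq_zero] at e
  · exact norm_le_zero_iff.1 e
  · intro i hi
    rw [iteratedFDerivWithin_of_isOpen i hU hq, h i (by simp at hi; omega)]
    simp

theorem mul {f g : ℝ × ℝ → ℝ} (hU : IsOpen U) (hq : q ∈ U)
    (hf : ContDiffOn ℝ ∞ f U) (hg : ContDiffOn ℝ ∞ g U) (h : VanishesTo n f q) :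
    VanishesTo n (fun x => f x * g x) q := h.smul hU hq hf hg

/-- The order of vanishing in terms of covariant derivatives. -/
theorem succ_iff_covD {ω₁ ω₂ : OneForm} (hc : IsCoframe U ω₁ ω₂) (hq : q ∈ U) (m : ℕ)
    {f : ℝ × ℝ → ℝ} (hf : ContDiffOn ℝ ∞ f U) :
    VanishesTo (n + 1) f q ↔ f q = 0 ∧ ∀ i, VanishesTo n (covD ω₁ ω₂ i m f) q := by
  have hU := hc.isOpen
  have hd : ContDiffOn ℝ ∞ (fderiv ℝ f) U := hf.fderiv_of_isOpen hU (by simp)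
  have hp : ∀ i, ContDiffOn ℝ ∞ (fun x => -(m * connCoeff ω₁ ω₂ i x)) U := fun i =>
    (contDiffOn_const.mul (hc.smooth_connCoeff i)).neg
  have hD : ∀ i, ContDiffOn ℝ ∞ (fun x => fderiv ℝ f x (frame ω₁ ω₂ i x)) U := fun i =>
    contDiffOn_fderiv_apply hU hf (hc.smooth_frame i)
  constructor
  · intro h
    have h' := succ_iff.1 h
    refine ⟨h'.1, fun i => ?_⟩
    refine congr hU hq (fun x _ => ?_) (add hU hq (hD i) (hf.mul (hp i))
      (h'.2.apply hU hq hd (hc.smooth_frame i)) ((h.of_le n.le_succ).mul hU hq hf (hp i)))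
    simp only [covD]
    ring
  · intro h
    induction n with
    | zero => exact succ_iff.2 ⟨h.1, fun k hk => absurd hk (by omega)⟩
    | succ n ih =>
      -- By induction `f` itself vanishes to order `n + 1`. This disposes of the connection term,
      -- the difference between `δᵢ f` and `∂ᵢ f`, so that all `∂ᵢ f`, and hence `df`, vanish to
      -- that order.
      have hn := ih ⟨h.1, fun i => (h.2 i).of_le n.le_succ⟩
      have hi : ∀ i, VanishesTo (n + 1) (fun x => fderiv ℝ f x (frame ω₁ ω₂ i x)) q := by
        intro i
        refine congr hU hq (fun x _ => ?_) (add hU hq (hc.smooth_covD hf i m) (hf.mul (hp i).neg)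
          (h.2 i) (hn.mul hU hq hf (hp i).neg))
        simp only [covD]
        ring
      refine succ_iff.2 ⟨h.1, ?_⟩
      exact congr hU hq (fun x hx => (hc.form_eq (fderiv ℝ f) hx).symm)
        (add hU hq ((hD 0).smul hc.smooth_one) ((hD 1).smul hc.smooth_two)
          ((hi 0).smul hU hq (hD 0) hc.smooth_one) ((hi 1).smul hU hq (hD 1) hc.smooth_two))

theorem zero_order {f : ℝ × ℝ → F} : VanishesTo 0 f q := fun _ hk => absurd hk (by omega)

end VanishesTo

/-- Ordinary and covariant derivatives of order at most two differ by a triangular change, so their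
joint vanishing is the same condition. The equations have weight two, hence the weights 2 and 3.
Orders `≤ 2` correspond to `VanishesTo 3`. -/
theorem jetInProlongation_iff {U : Set (ℝ × ℝ)} {ω₁ ω₂ : OneForm} (hc : IsCoframe U ω₁ ω₂)
    (a b : ℝ) {w u v : ℝ × ℝ → ℝ} (hw : ContDiffOn ℝ ∞ w U)
    (hu : ContDiffOn ℝ ∞ u U) (hv : ContDiffOn ℝ ∞ v U) {q : ℝ × ℝ} (hq : q ∈ U) :
    JetInProlongation ω₁ ω₂ (fun _ => a) (fun _ => b) w u v q ↔
      let e := hc.calculus.system (SmoothFn.const U a) (SmoothFn.const U b)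
        (SmoothFn.mk w hw) (SmoothFn.mk u hu) (SmoothFn.mk v hv)
      ∀ j, SmoothFn.eval hq (e j) = 0 ∧ (∀ i, SmoothFn.eval hq (hc.calculus.D i 2 (e j)) = 0) ∧
        ∀ i i', SmoothFn.eval hq (hc.calculus.D i 3 (hc.calculus.D i' 2 (e j))) = 0 := by
  simp only [hc.system_mk, hc.D_mk, SmoothFn.eval_mk]
  refine forall_congr' fun j => ?_
  have hs := hc.smooth_abelianSystem a b hw hu hv j
  have e1 : (∀ k ≤ 2, iteratedFDeriv ℝ k
      (abelianSystem ω₁ ω₂ (fun _ => a) (fun _ => b) w u v j) q = 0) ↔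
      VanishesTo 3 (abelianSystem ω₁ ω₂ (fun _ => a) (fun _ => b) w u v j) q :=
    forall_congr' fun k => by rw [Nat.lt_succ_iff]
  rw [e1, VanishesTo.succ_iff_covD hc hq 2 hs]
  have e2 : ∀ i, VanishesTo 2 (covD ω₁ ω₂ i 2
      (abelianSystem ω₁ ω₂ (fun _ => a) (fun _ => b) w u v j)) q ↔ _ := fun i =>
    VanishesTo.succ_iff_covD hc hq 3 (hc.smooth_covD hs i 2)
  have e3 : ∀ i i', VanishesTo 1 (covD ω₁ ω₂ i' 3 (covD ω₁ ω₂ i 2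
      (abelianSystem ω₁ ω₂ (fun _ => a) (fun _ => b) w u v j))) q ↔ _ := fun i i' =>
    VanishesTo.succ_iff_covD hc hq 4 (hc.smooth_covD (hc.smooth_covD hs i 2) i' 3)
  simp only [e2, e3, VanishesTo.zero_order, implies_true, and_true]
  constructor
  · rintro ⟨h0, h⟩
    exact ⟨h0, fun i => (h i).1, fun i i' => (h i').2 i⟩
  · rintro ⟨h0, h1, h2⟩
    exact ⟨h0, fun i => ⟨h1 i, fun i' => h2 i' i⟩⟩

theorem vanishesTo_four_of_jetVanishes {U : Set (ℝ × ℝ)} {ω₁ ω₂ : OneForm}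
    (hc : IsCoframe U ω₁ ω₂) {f : ℝ × ℝ → ℝ} (hf : ContDiffOn ℝ ∞ f U) {q : ℝ × ℝ} (hq : q ∈ U)
    (h : hc.calculus.JetVanishes (SmoothFn.eval hq) (SmoothFn.mk f hf)) : VanishesTo 4 f q := by
  obtain ⟨h0, h1, h2, h3⟩ := h
  simp only [hc.D_mk, SmoothFn.eval_mk] at h0 h1 h2 h3
  refine (VanishesTo.succ_iff_covD hc hq 1 hf).2 ⟨h0, fun i => ?_⟩
  have s1 := hc.smooth_covD hf i 1
  refine (VanishesTo.succ_iff_covD hc hq 2 s1).2 ⟨h1 i, fun j => ?_⟩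
  have s2 := hc.smooth_covD s1 j 2
  refine (VanishesTo.succ_iff_covD hc hq 3 s2).2 ⟨h2 j i, fun k => ?_⟩
  exact (VanishesTo.succ_iff_covD hc hq 4 (hc.smooth_covD s2 k 3)).2
    ⟨h3 k j i, fun _ => VanishesTo.zero_order⟩

/-! ## Cubic polynomials -/

/-- The cubic polynomial with given Taylor coefficients at `q`. -/
def cubic (q : ℝ × ℝ) (c : Fin 10 → ℝ) (p : ℝ × ℝ) : ℝ :=
  c 0 + c 1 * (p.1 - q.1) + c 2 * (p.2 - q.2) + c 3 * ((p.1 - q.1) ^ 2 / 2) +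
    c 4 * ((p.1 - q.1) * (p.2 - q.2)) + c 5 * ((p.2 - q.2) ^ 2 / 2) +
    c 6 * ((p.1 - q.1) ^ 3 / 6) + c 7 * ((p.1 - q.1) ^ 2 / 2 * (p.2 - q.2)) +
    c 8 * ((p.1 - q.1) * ((p.2 - q.2) ^ 2 / 2)) + c 9 * ((p.2 - q.2) ^ 3 / 6)

theorem contDiff_cubic (q : ℝ × ℝ) (c : Fin 10 → ℝ) : ContDiff ℝ ∞ (cubic q c) := by
  unfold cubic
  fun_prop

/-- Thanks to the factorials in `cubic`, differentiation merely shifts the coefficient vector. -/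
theorem fderiv_cubic (q : ℝ × ℝ) (c : Fin 10 → ℝ) (p v : ℝ × ℝ) :
    fderiv ℝ (cubic q c) p v =
      cubic q ![c 1, c 3, c 4, c 6, c 7, c 8, 0, 0, 0, 0] p * v.1 +
      cubic q ![c 2, c 4, c 5, c 7, c 8, c 9, 0, 0, 0, 0] p * v.2 := by
  have hx : HasFDerivAt (fun p : ℝ × ℝ => p.1 - q.1) (ContinuousLinearMap.fst ℝ ℝ ℝ) p :=
    hasFDerivAt_fst.sub_const _
  have hy : HasFDerivAt (fun p : ℝ × ℝ => p.2 - q.2) (ContinuousLinearMap.snd ℝ ℝ ℝ) p :=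
    hasFDerivAt_snd.sub_const _
  have h := (((((((((hasFDerivAt_const (c 0) p).add (hx.const_mul (c 1))).add
    (hy.const_mul (c 2))).add (((hx.pow 2).mul_const (2⁻¹ : ℝ)).const_mul (c 3))).add
    ((hx.mul hy).const_mul (c 4))).add (((hy.pow 2).mul_const (2⁻¹ : ℝ)).const_mul (c 5))).add
    (((hx.pow 3).mul_const (6⁻¹ : ℝ)).const_mul (c 6))).add
    ((((hx.pow 2).mul_const (2⁻¹ : ℝ)).mul hy).const_mul (c 7))).add
    ((hx.mul ((hy.pow 2).mul_const (2⁻¹ : ℝ))).const_mul (c 8))).add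
    (((hy.pow 3).mul_const (6⁻¹ : ℝ)).const_mul (c 9))
  have h' : HasFDerivAt (cubic q c) _ p := h
  rw [h'.fderiv]
  simp [cubic]
  ring

/-- Each partial derivative is again a `cubic` with shifted coefficients, so the ten coefficients
are read off one at a time as values at `q`. -/
theorem VanishesTo.cubic_eq_zero {q : ℝ × ℝ} {c : Fin 10 → ℝ} (h : VanishesTo 4 (cubic q c) q) :
    c = 0 := by
  have key : ∀ (n : ℕ) (c : Fin 10 → ℝ), VanishesTo (n + 1) (cubic q c) q →
      c 0 = 0 ∧ VanishesTo n (cubic q ![c 1, c 3, c 4, c 6, c 7, c 8, 0, 0, 0, 0]) q ∧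
        VanishesTo n (cubic q ![c 2, c 4, c 5, c 7, c 8, c 9, 0, 0, 0, 0]) q := by
    intro n c h
    obtain ⟨h0, h1⟩ := VanishesTo.succ_iff.1 h
    have hd : ContDiffOn ℝ ∞ (fderiv ℝ (cubic q c)) Set.univ :=
      (contDiff_cubic q c).contDiffOn.fderiv_of_isOpen isOpen_univ (by simp)
    refine ⟨by simpa [cubic] using h0, ?_, ?_⟩
    · refine VanishesTo.congr isOpen_univ (Set.mem_univ q) (fun x _ => ?_)
        (h1.apply (v := fun _ => (1, 0)) isOpen_univ (Set.mem_univ q) hd contDiffOn_const)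
      simp [fderiv_cubic]
    · refine VanishesTo.congr isOpen_univ (Set.mem_univ q) (fun x _ => ?_)
        (h1.apply (v := fun _ => (0, 1)) isOpen_univ (Set.mem_univ q) hd contDiffOn_const)
      simp [fderiv_cubic]
  obtain ⟨h0, hx, hy⟩ := key 3 c h
  obtain ⟨h1, hxx, hxy⟩ := key 2 _ hx
  obtain ⟨h2, -, hyy⟩ := key 2 _ hy
  obtain ⟨h3, hxxx, hxxy⟩ := key 1 _ hxx
  obtain ⟨h4, -, hxyy⟩ := key 1 _ hxy
  obtain ⟨h5, -, hyyy⟩ := key 1 _ hyy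
  have h6 := (key 0 _ hxxx).1
  have h7 := (key 0 _ hxxy).1
  have h8 := (key 0 _ hxyy).1
  have h9 := (key 0 _ hyyy).1
  simp only [Matrix.cons_val] at h1 h2 h3 h4 h5 h6 h7 h8 h9
  ext i
  fin_cases i <;> assumption

/-! ## The obstruction -/

/-- The coefficients of the obstruction. -/
def obstructionCoeff (ω₁ ω₂ : OneForm) (a b : ℝ) (q : ℝ × ℝ) : Fin 6 → ℝ :=
  let K := curvature ω₁ ω₂ q
  let K₁ := curvatureD ω₁ ω₂ 0 q
  let K₂ := curvatureD ω₁ ω₂ 1 q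
  let K₁₁ := curvatureDD ω₁ ω₂ 0 0 q
  let K₁₂ := curvatureDD ω₁ ω₂ 0 1 q
  let K₂₂ := curvatureDD ω₁ ω₂ 1 1 q
  ![K, (b * K₂ - K₁) / (2 * (b - 1)), b * (a - b) * (K₂ - K₁) / (2 * (a - 1) * (b - 1)),
    (K₁₁ - (a + b) * K₁₂ + a * b * K₂₂ + 5 * (a + b - 2) * K ^ 2) / (10 * (a - 1) * (b - 1)),
    a * (K₁₁ - (b + 1) * K₁₂ + b * K₂₂ + 5 * (b - 1) * K ^ 2) / (10 * (a - 1) * (b - 1)),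
    b * (K₁₁ - (a + 1) * K₁₂ + a * K₂₂ + 5 * (a - 1) * K ^ 2) / (10 * (a - 1) * (b - 1))]

section

variable {U : Set (ℝ × ℝ)} {ω₁ ω₂ : OneForm} (h : IsCoframe U ω₁ ω₂) {a b : ℝ} {q : ℝ × ℝ}

include h

/-- Since `K` has weight two, the commutator of `δ₁, δ₂` on it is `2K²`; symmetrizing adds half of
this. -/
theorem IsCoframe.curvatureDD_zero_one (hq : q ∈ U) :
    curvatureDD ω₁ ω₂ 0 1 q = covD ω₁ ω₂ 0 3 (covD ω₁ ω₂ 1 2 (curvature ω₁ ω₂)) q +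
      curvature ω₁ ω₂ q ^ 2 := by
  have e := h.covD_comm h.smooth_curvature 2 hq
  push_cast at e
  simp only [curvatureDD, curvatureD]
  linear_combination e / 2

omit h in
theorem curvatureDD_self (ω₁ ω₂ : OneForm) (q : ℝ × ℝ) (i : Fin 2) :
    curvatureDD ω₁ ω₂ i i q = covD ω₁ ω₂ i 3 (covD ω₁ ω₂ i 2 (curvature ω₁ ω₂)) q := by
  simp only [curvatureDD, curvatureD]
  ring

/-- The obstruction evaluated on the prolongation of the abelian system. -/
theorem eval_bracket (hq : q ∈ U) (ha : a ≠ 1) (hb : b ≠ 1) {w u v : SmoothFn U}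
    (h0 : ∀ j, SmoothFn.eval hq
      (h.calculus.system (SmoothFn.const U a) (SmoothFn.const U b) w u v j) = 0)
    (h1 : ∀ i j, SmoothFn.eval hq (h.calculus.D i 2
      (h.calculus.system (SmoothFn.const U a) (SmoothFn.const U b) w u v j)) = 0) :
    SmoothFn.eval hq (h.calculus.bracket (SmoothFn.const U a) (SmoothFn.const U b) w u v) =
      -10 * (a - 1) * (b - 1) * ∑ i, obstructionCoeff ω₁ ω₂ a b q i *
        SmoothFn.eval hq (h.calculus.coords w u v i) := by
  have ha' : a - 1 ≠ 0 := sub_ne_zero.2 ha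
  have hb' : b - 1 ≠ 0 := sub_ne_zero.2 hb
  rw [WeightedCalculus.bracket_reduce (h.isConst_const a) (h.isConst_const b) _ h0 h1]
  have hK : h.calculus.K = SmoothFn.mk (curvature ω₁ ω₂) h.smooth_curvature := rfl
  simp only [hK, h.D_mk, SmoothFn.eval_mk, SmoothFn.eval_const, Fin.sum_univ_six, obstructionCoeff,
    h.curvatureDD_zero_one hq, curvatureDD_self, WeightedCalculus.coords, Matrix.cons_val]
  simp only [curvatureD]
  field_simp
  ring

theorem isObstructionAt_obstructionCoeff (hq : q ∈ U) (ha : a ≠ 1) (hb : b ≠ 1) :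
    IsObstructionAt U ω₁ ω₂ (fun _ => a) (fun _ => b) q (obstructionCoeff ω₁ ω₂ a b q) := by
  intro w u v hw hu hv hj
  have hj' := (jetInProlongation_iff h a b hw hu hv hq).1 hj
  rw [h.kappa_eq a b hw hu hv hq,
    eval_bracket h hq ha hb (fun j => (hj' j).1) (fun i j => (hj' j).2.1 i)]
  simp only [Fin.sum_univ_six, WeightedCalculus.coords, Matrix.cons_val, h.D_mk, SmoothFn.eval_mk]

/-- The cubic polynomials as smooth functions on `U`. -/
def cubicFn (U : Set (ℝ × ℝ)) (q : ℝ × ℝ) (c : Fin 10 → ℝ) : SmoothFn U :=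
  SmoothFn.mk (cubic q c) (contDiff_cubic q c).contDiffOn

omit h in
theorem cubicFn_add (c d : Fin 10 → ℝ) : cubicFn U q (c + d) = cubicFn U q c + cubicFn U q d := by
  refine Subtype.ext (funext fun x => ?_)
  change cubic q (c + d) x = cubic q c x + cubic q d x
  simp only [cubic, Pi.add_apply]
  ring

omit h in
theorem cubicFn_smul (r : ℝ) (c : Fin 10 → ℝ) :
    cubicFn U q (r • c) = SmoothFn.const U r * cubicFn U q c := by
  refine Subtype.ext (funext fun x => ?_)
  change cubic q (r • c) x = r * cubic q c x
  simp only [cubic, Pi.smul_apply, smul_eq_mul]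
  ring

/-- The values at `q` of the abelian system on a triple of cubic polynomials, of its derivatives of
order at most two, and of the fibre coordinates. -/
def jetMap (a b : ℝ) (hq : q ∈ U) : (Fin 3 → Fin 10 → ℝ) →ₗ[ℝ]
    (Fin 4 → ℝ × (Fin 2 → ℝ) × (Fin 3 → ℝ)) × (Fin 6 → ℝ) where
  toFun c :=
    let e := h.calculus.system (SmoothFn.const U a) (SmoothFn.const U b)
      (cubicFn U q (c 0)) (cubicFn U q (c 1)) (cubicFn U q (c 2))
    (fun j => (SmoothFn.eval hq (e j), fun i => SmoothFn.eval hq (h.calculus.D i 2 (e j)),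
      ![SmoothFn.eval hq (h.calculus.D 0 3 (h.calculus.D 0 2 (e j))),
        SmoothFn.eval hq (h.calculus.D 0 3 (h.calculus.D 1 2 (e j))),
        SmoothFn.eval hq (h.calculus.D 1 3 (h.calculus.D 1 2 (e j)))]),
     fun i => SmoothFn.eval hq (h.calculus.coords
      (cubicFn U q (c 0)) (cubicFn U q (c 1)) (cubicFn U q (c 2)) i))
  map_add' c d := by
    simp only [Pi.add_apply, cubicFn_add, WeightedCalculus.system_add, WeightedCalculus.coords_add,
      h.calculus.D_add, map_add]
    refine Prod.ext (funext fun j => Prod.ext rfl (Prod.ext rfl (funext fun i => ?_))) rfl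
    fin_cases i <;> rfl
  map_smul' r c := by
    have hr := h.isConst_const r
    simp only [Pi.smul_apply, cubicFn_smul, WeightedCalculus.system_const_mul _ _ hr,
      WeightedCalculus.coords_const_mul hr, hr.D_mul, map_mul, SmoothFn.eval_const]
    refine Prod.ext (funext fun j => Prod.ext rfl (Prod.ext rfl (funext fun i => ?_))) rfl
    fin_cases i <;> rfl

/-- Source and target both have dimension 30, the target as `4 · (1 + 2 + 3) + 6`. Injectivity is
`jets_vanish`: a cubic with zero 3-jet is zero. -/
theorem jetMap_surjective (hq : q ∈ U) (ha0 : a ≠ 0) (hb0 : b ≠ 0) (ha : a ≠ 1) (hb : b ≠ 1)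
    (hab : a ≠ b) : Function.Surjective (jetMap h a b hq) := by
  refine (LinearMap.injective_iff_surjective_of_finrank_eq_finrank
    (by simp [Module.finrank_pi_fintype])).1 ?_
  refine (injective_iff_map_eq_zero _).2 fun c hc => ?_
  have h1 := fun j => congrFun (congrArg Prod.fst hc) j
  have h2 := fun i => congrFun (congrArg Prod.snd hc) i
  have h3 := fun j => congrArg Prod.fst (h1 j)
  have h4 := fun j => congrArg Prod.fst (congrArg Prod.snd (h1 j))
  have h5 := fun j => congrArg Prod.snd (congrArg Prod.snd (h1 j))
  have hu : ∀ x : ℝ, x ≠ 0 → IsUnit x := fun x hx => hx.isUnit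
  obtain ⟨e0, e1, e2⟩ := WeightedCalculus.jets_vanish (SmoothFn.eval hq)
    (w := cubicFn U q (c 0)) (u := cubicFn U q (c 1)) (v := cubicFn U q (c 2))
    (h.isConst_const a) (h.isConst_const b) (hu _ ha0) (hu _ hb0) (hu _ (sub_ne_zero.2 ha))
    (hu _ (sub_ne_zero.2 hb)) (hu _ (sub_ne_zero.2 hab)) h3 (fun i j => congrFun (h4 j) i)
    (fun j => congrFun (h5 j) 0) (fun j => congrFun (h5 j) 1) (fun j => congrFun (h5 j) 2) h2
  funext i
  fin_cases i
  · exact (vanishesTo_four_of_jetVanishes h _ hq e0).cubic_eq_zero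
  · exact (vanishesTo_four_of_jetVanishes h _ hq e1).cubic_eq_zero
  · exact (vanishesTo_four_of_jetVanishes h _ hq e2).cubic_eq_zero

/-- The fibre coordinates take arbitrary values on the prolongation of the abelian system. -/
theorem exists_jetInProlongation (hq : q ∈ U) (ha0 : a ≠ 0) (hb0 : b ≠ 0) (ha : a ≠ 1) (hb : b ≠ 1)
    (hab : a ≠ b) (t : Fin 6 → ℝ) : ∃ w u v : ℝ × ℝ → ℝ, ContDiffOn ℝ ∞ w U ∧
      ContDiffOn ℝ ∞ u U ∧ ContDiffOn ℝ ∞ v U ∧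
      JetInProlongation ω₁ ω₂ (fun _ => a) (fun _ => b) w u v q ∧
      ![covD ω₁ ω₂ 1 2 (covD ω₁ ω₂ 1 1 w) q, covD ω₁ ω₂ 1 1 w q, covD ω₁ ω₂ 1 1 v q,
        w q, u q, v q] = t := by
  obtain ⟨c, hc⟩ := jetMap_surjective h hq ha0 hb0 ha hb hab (0, t)
  have h1 := fun j => congrFun (congrArg Prod.fst hc) j
  have h2 := fun i => congrFun (congrArg Prod.snd hc) i
  have h3 := fun j => congrArg Prod.fst (h1 j)
  have h4 := fun j => congrArg Prod.fst (congrArg Prod.snd (h1 j))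
  have h5 := fun j => congrArg Prod.snd (congrArg Prod.snd (h1 j))
  have s := fun i => (contDiff_cubic q (c i)).contDiffOn (s := U)
  refine ⟨_, _, _, s 0, s 1, s 2,
    (jetInProlongation_iff h a b (s 0) (s 1) (s 2) hq).2 fun j => ⟨h3 j, congrFun (h4 j), ?_⟩,
    funext fun i => ?_⟩
  · intro i i'
    have e00 := congrFun (h5 j) 0
    have e01 := congrFun (h5 j) 1
    have e11 := congrFun (h5 j) 2
    fin_cases i <;> fin_cases i'
    · exact e00
    · exact e01
    -- `jetMap` does not record `δ₂δ₁`. It differs from `δ₁δ₂` by a multiple of the equation itself,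
    -- which vanishes at `q`.
    · refine (congrArg (SmoothFn.eval hq) (WeightedCalculus.D_comm_two _)).trans ?_
      rw [map_add, map_add, map_mul]
      have e0 := h3 j
      simp only [cubicFn, jetMap] at e0 e01
      refine (congrArg₂ (· + ·) e01 (congrArg₂ (· + ·) (congrArg (_ * ·) e0)
        (congrArg (_ * ·) e0))).trans ?_
      simp
    · exact e11
  · refine Eq.trans ?_ (h2 i)
    fin_cases i
    · simp only [jetMap, cubicFn, LinearMap.coe_mk, AddHom.coe_mk, WeightedCalculus.coords, h.D_mk,
        Matrix.cons_val, SmoothFn.eval_mk, Fin.zero_eta]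
    all_goals
      simp only [jetMap, cubicFn, LinearMap.coe_mk, AddHom.coe_mk, WeightedCalculus.coords, h.D_mk,
        Fin.reduceFinMk, Matrix.cons_val, SmoothFn.eval_mk, Fin.mk_one]

/-- Uniqueness: jets in the prolongation realize every unit vector of coordinates, and testing on
the `i`-th isolates `c i`, the common factor being nonzero. -/
theorem isObstructionAt_iff (hq : q ∈ U) (ha0 : a ≠ 0) (hb0 : b ≠ 0) (ha : a ≠ 1) (hb : b ≠ 1)
    (hab : a ≠ b) (c : Fin 6 → ℝ) :
    IsObstructionAt U ω₁ ω₂ (fun _ => a) (fun _ => b) q c ↔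
      c = obstructionCoeff ω₁ ω₂ a b q := by
  refine ⟨fun hc => ?_, fun hc => hc ▸ isObstructionAt_obstructionCoeff h hq ha hb⟩
  funext i
  obtain ⟨w, u, v, hw, hu, hv, hj, ht⟩ :=
    exists_jetInProlongation h hq ha0 hb0 ha hb hab (Pi.single i 1)
  have e := (hc w u v hw hu hv hj).symm.trans
    (isObstructionAt_obstructionCoeff h hq ha hb w u v hw hu hv hj)
  have hne : -10 * (a - 1) * (b - 1) ≠ 0 :=
    mul_ne_zero (mul_ne_zero (by norm_num) (sub_ne_zero.2 ha)) (sub_ne_zero.2 hb)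
  have e' := mul_left_cancel₀ hne e
  have key : ∀ d : Fin 6 → ℝ, d 0 * covD ω₁ ω₂ 1 2 (covD ω₁ ω₂ 1 1 w) q +
      d 1 * covD ω₁ ω₂ 1 1 w q + d 2 * covD ω₁ ω₂ 1 1 v q + d 3 * w q + d 4 * u q + d 5 * v q =
      d i := by
    intro d
    have : ∑ k, d k * (Pi.single i 1 : Fin 6 → ℝ) k = d i := by simp [Pi.single_apply]
    rw [← this, ← ht, Fin.sum_univ_six]
    rfl
  rwa [key, key] at e'

end

/-- The coefficient `c₀` is `K`, and every coefficient is built from `K` and its covariant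
derivatives without a constant term. -/
theorem obstructionCoeff_eq_zero_iff {U : Set (ℝ × ℝ)} {ω₁ ω₂ : OneForm} (h : IsCoframe U ω₁ ω₂)
    (a b : ℝ) : (∀ q ∈ U, ∀ i, obstructionCoeff ω₁ ω₂ a b q i = 0) ↔
      ∀ q ∈ U, curvature ω₁ ω₂ q = 0 := by
  refine ⟨fun hc q hq => hc q hq 0, fun hK q hq i => ?_⟩
  have z : ∀ i k, Set.EqOn (covD ω₁ ω₂ i k fun _ => 0) (fun _ => 0) U := fun i k x _ => by
    simp [covD]
  have e1 : ∀ i, Set.EqOn (curvatureD ω₁ ω₂ i) (fun _ => 0) U := fun i x hx =>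
    (h.covD_congr (g := fun _ => 0) hK i 2 hx).trans (z i 2 hx)
  have e2 : ∀ i j, curvatureDD ω₁ ω₂ i j q = 0 := by
    intro i j
    simp only [curvatureDD]
    rw [h.covD_congr (e1 j) i 3 hq, h.covD_congr (e1 i) j 3 hq, z i 3 hq, z j 3 hq]
    simp
  fin_cases i <;> simp [obstructionCoeff, hK q hq, e1 _ hq, e2]

/-! ## Normalizations -/

theorem wedge_ne_zero_of_linearIndependent {α β : OneForm} {q : ℝ × ℝ}
    (h : LinearIndependent ℝ ![α q, β q]) : wedge α β q ≠ 0 := by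
  intro h0
  rw [LinearIndependent.pair_iff] at h
  simp only [wedge] at h0
  -- If the wedge vanishes, `β(e) α - α(e) β = 0` for each basis vector `e`, so independence forces
  -- `α = 0`.
  have e1 := h (β q (1, 0)) (-α q (1, 0)) (by
    apply clm_eq_of_coeffs <;> simp <;> linarith)
  have e2 := h (β q (0, 1)) (-α q (0, 1)) (by
    apply clm_eq_of_coeffs <;> simp <;> linarith)
  have hα : α q = 0 := by
    apply clm_eq_of_coeffs
    · simpa using e1.2
    · simpa using e2.2
  have := (h 1 0 (by simp [hα])).1
  exact one_ne_zero this

theorem IsWeb.wedge_ne_zero {d : ℕ} {D : Set (ℝ × ℝ)} {W : Fin d → OneForm} (hW : IsWeb D W)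
    {q : ℝ × ℝ} (hq : q ∈ D) {i j : Fin d} (hij : i ≠ j) : wedge (W i) (W j) q ≠ 0 :=
  wedge_ne_zero_of_linearIndependent (hW.transversal q hq i j hij)

theorem wedge_smul_smul {α β α' β' : OneForm} {q : ℝ × ℝ} {s t : ℝ} (hα : α' q = s • α q)
    (hβ : β' q = t • β q) : wedge α' β' q = s * t * wedge α β q := by
  simp only [wedge, hα, hβ, smul_apply, smul_eq_mul]
  ring

namespace IsNormalization

variable {D U : Set (ℝ × ℝ)} {W θ : Fin 5 → OneForm} {a b : ℝ}

theorem wedge_ne_zero (hN : IsNormalization U W θ (fun _ => a) (fun _ => b)) (hW : IsWeb D W)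
    (hU : U ⊆ D) {q : ℝ × ℝ} (hq : q ∈ U) {i j : Fin 5} (hij : i ≠ j) :
    wedge (θ i) (θ j) q ≠ 0 := by
  obtain ⟨s, hs, es⟩ := hN.scaling i q hq
  obtain ⟨t, ht, et⟩ := hN.scaling j q hq
  rw [wedge_smul_smul es et]
  exact mul_ne_zero (mul_ne_zero hs ht) (hW.wedge_ne_zero (hU hq) hij)

theorem isCoframe (hN : IsNormalization U W θ (fun _ => a) (fun _ => b)) (hW : IsWeb D W)
    (hUo : IsOpen U) (hU : U ⊆ D) : IsCoframe U (θ 0) (θ 1) :=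
  ⟨hUo, hN.smooth 0, hN.smooth 1, fun _ hq => hN.wedge_ne_zero hW hU hq (by decide)⟩

theorem theta_two (hN : IsNormalization U W θ (fun _ => a) (fun _ => b)) {q : ℝ × ℝ}
    (hq : q ∈ U) : θ 2 q = -(θ 0 q + θ 1 q) := (neg_eq_of_add_eq_zero_right (hN.rel_three q hq)).symm

theorem theta_three (hN : IsNormalization U W θ (fun _ => a) (fun _ => b)) {q : ℝ × ℝ}
    (hq : q ∈ U) : θ 3 q = -(a • θ 0 q + θ 1 q) :=
  (neg_eq_of_add_eq_zero_right (hN.rel_four q hq)).symm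

theorem theta_four (hN : IsNormalization U W θ (fun _ => a) (fun _ => b)) {q : ℝ × ℝ}
    (hq : q ∈ U) : θ 4 q = -(b • θ 0 q + θ 1 q) :=
  (neg_eq_of_add_eq_zero_right (hN.rel_five q hq)).symm

/-- Basic invariants avoid `0` and `1` and differ from each other. -/
theorem nondegenerate (hN : IsNormalization U W θ (fun _ => a) (fun _ => b)) (hW : IsWeb D W)
    (hU : U ⊆ D) {q : ℝ × ℝ} (hq : q ∈ U) : a ≠ 0 ∧ b ≠ 0 ∧ a ≠ 1 ∧ b ≠ 1 ∧ a ≠ b := by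
  have h13 := hN.wedge_ne_zero hW hU hq (i := 1) (j := 3) (by decide)
  have h14 := hN.wedge_ne_zero hW hU hq (i := 1) (j := 4) (by decide)
  have h23 := hN.wedge_ne_zero hW hU hq (i := 2) (j := 3) (by decide)
  have h24 := hN.wedge_ne_zero hW hU hq (i := 2) (j := 4) (by decide)
  have h34 := hN.wedge_ne_zero hW hU hq (i := 3) (j := 4) (by decide)
  simp only [wedge, hN.theta_two hq, hN.theta_three hq, hN.theta_four hq, neg_apply, add_apply,
    smul_apply, smul_eq_mul] at h13 h14 h23 h24 h34
  refine ⟨?_, ?_, ?_, ?_, ?_⟩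
  · rintro rfl
    exact h13 (by ring)
  · rintro rfl
    exact h14 (by ring)
  · rintro rfl
    exact h23 (by ring)
  · rintro rfl
    exact h24 (by ring)
  · rintro rfl
    exact h34 (by ring)

end IsNormalization

/-- Smooth nonvanishing factors that normalize a 5-web with constant basic invariants. -/
theorem IsWeb.exists_scaling {D : Set (ℝ × ℝ)} {W : Fin 5 → OneForm} (hW : IsWeb D W) {a b : ℝ}
    (ha : ∀ q ∈ D, basicInvariant W 3 q = a) (hb : ∀ q ∈ D, basicInvariant W 4 q = b) :
    ∃ s : Fin 5 → ℝ × ℝ → ℝ, (∀ i, ContDiffOn ℝ ∞ (s i) D) ∧ (∀ i, ∀ q ∈ D, s i q ≠ 0) ∧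
      IsNormalization D W (fun i q => s i q • W i q) (fun _ => a) (fun _ => b) := by
  have hw : ∀ i j, ContDiffOn ℝ ∞ (wedge (W i) (W j)) D := fun i j =>
    contDiffOn_wedge (hW.smooth i) (hW.smooth j)
  have h01 := fun q hq => hW.wedge_ne_zero (q := q) hq (i := 0) (j := 1) (by decide)
  have h02 := fun q hq => hW.wedge_ne_zero (q := q) hq (i := 0) (j := 2) (by decide)
  have h12 := fun q hq => hW.wedge_ne_zero (q := q) hq (i := 1) (j := 2) (by decide)
  have h03 := fun q hq => hW.wedge_ne_zero (q := q) hq (i := 0) (j := 3) (by decide)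
  have h04 := fun q hq => hW.wedge_ne_zero (q := q) hq (i := 0) (j := 4) (by decide)
  -- The first three factors are those of the Cramer relation among `W 0, W 1, W 2`. The other two
  -- rescale the relation for `W 0, W 1, W k` to have the same coefficient at `W 1`; its coefficient
  -- at `W 0` is then the cross-ratio times `s 0`.
  let s : Fin 5 → ℝ × ℝ → ℝ := ![wedge (W 1) (W 2), fun q => -wedge (W 0) (W 2) q,
    wedge (W 0) (W 1), fun q => wedge (W 0) (W 2) q * wedge (W 0) (W 1) q / wedge (W 0) (W 3) q,
    fun q => wedge (W 0) (W 2) q * wedge (W 0) (W 1) q / wedge (W 0) (W 4) q]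
  have hs : ∀ i, ContDiffOn ℝ ∞ (s i) D := by
    intro i
    fin_cases i
    · exact hw 1 2
    · exact (hw 0 2).neg
    · exact hw 0 1
    · exact ((hw 0 2).mul (hw 0 1)).div (hw 0 3) h03
    · exact ((hw 0 2).mul (hw 0 1)).div (hw 0 4) h04
  have hs0 : ∀ i, ∀ q ∈ D, s i q ≠ 0 := by
    intro i q hq
    fin_cases i
    · exact h12 q hq
    · exact neg_ne_zero.2 (h02 q hq)
    · exact h01 q hq
    · exact div_ne_zero (mul_ne_zero (h02 q hq) (h01 q hq)) (h03 q hq)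
    · exact div_ne_zero (mul_ne_zero (h02 q hq) (h01 q hq)) (h04 q hq)
  have cramer : ∀ (i j k : Fin 5) (q : ℝ × ℝ), wedge (W j) (W k) q • W i q +
      -wedge (W i) (W k) q • W j q + wedge (W i) (W j) q • W k q = 0 := by
    intro i j k q
    apply clm_eq_of_coeffs <;>
      simp only [wedge, add_apply, smul_apply, smul_eq_mul, zero_apply] <;> ring
  have scaled : ∀ (k : Fin 5) (c : ℝ) (q : ℝ × ℝ), q ∈ D → wedge (W 0) (W k) q ≠ 0 →
      basicInvariant W k q = c → c • (wedge (W 1) (W 2) q • W 0 q) + -wedge (W 0) (W 2) q • W 1 q +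
        (wedge (W 0) (W 2) q * wedge (W 0) (W 1) q / wedge (W 0) (W k) q) • W k q = 0 := by
    intro k c q hq hk hc
    have e := congrArg (fun x => (wedge (W 0) (W 2) q / wedge (W 0) (W k) q) • x) (cramer 0 1 k q)
    simp only [smul_zero] at e
    rw [← e, ← hc, basicInvariant]
    have := h12 q hq
    simp only [smul_add, smul_smul]
    congr 2
    · congr 1
      field_simp
    · congr 1
      field_simp
    · ring
  refine ⟨s, hs, hs0, fun i => (hs i).smul (hW.smooth i), fun i q hq => ⟨s i q, hs0 i q hq, rfl⟩,
    fun q _ => cramer 0 1 2 q, fun q hq => scaled 3 a q hq (h03 q hq) (ha q hq),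
    fun q hq => scaled 4 b q hq (h04 q hq) (hb q hq)⟩

/-! ## Uniqueness for total linear systems -/

/-- A solution of a total linear differential system that vanishes at a point vanishes nearby. -/
theorem eventually_eq_zero_of_fderiv_eq {n : ℕ} {U : Set (ℝ × ℝ)} (hU : IsOpen U)
    {y : Fin n → ℝ × ℝ → ℝ} {N : Fin n → Fin n → OneForm}
    (hy : ∀ k, ∀ x ∈ U, HasFDerivAt (y k) (∑ j, y j x • N k j x) x)
    (hN : ∀ k j, ContinuousOn (N k j) U) {p : ℝ × ℝ} (hp : p ∈ U) (h0 : ∀ k, y k p = 0) :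
    ∀ᶠ x in 𝓝 p, ∀ k, y k x = 0 := by
  obtain ⟨r, hr, hrU⟩ := Metric.nhds_basis_closedBall.mem_iff.1 (hU.mem_nhds hp)
  have hK : IsCompact (Metric.closedBall p r) := isCompact_closedBall p r
  have hb : ∀ k j, ∃ C, ∀ x ∈ Metric.closedBall p r, ‖N k j x‖ ≤ C := fun k j =>
    hK.exists_bound_of_continuousOn ((hN k j).mono hrU)
  choose C hC using hb
  filter_upwards [Metric.closedBall_mem_nhds p hr] with x hx
  have hseg : ∀ t ∈ Set.Icc (0 : ℝ) 1, p + t • (x - p) ∈ Metric.closedBall p r := by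
    intro t ht
    rw [mem_closedBall_iff_norm, add_sub_cancel_left, norm_smul, Real.norm_of_nonneg ht.1]
    rw [mem_closedBall_iff_norm] at hx
    nlinarith [norm_nonneg (x - p), ht.2]
  -- Along the segment from `p` to `x` the system is a linear ODE with zero initial value. The
  -- matrix is bounded on the compact ball, so Grönwall's inequality gives zero at time 1.
  let f : ℝ → Fin n → ℝ := fun t k => y k (p + t • (x - p))
  let f' : ℝ → Fin n → ℝ := fun t k => ∑ j, y j (p + t • (x - p)) * N k j (p + t • (x - p)) (x - p)
  have hf : ∀ t ∈ Set.Icc (0 : ℝ) 1, HasDerivAt f (f' t) t := by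
    intro t ht
    refine hasDerivAt_pi.2 fun k => ?_
    have hl : HasDerivAt (fun t : ℝ => p + t • (x - p)) (x - p) t := by
      simpa using ((hasDerivAt_id t).smul_const (x - p)).const_add p
    have := (hy k _ (hrU (hseg t ht))).comp_hasDerivAt t hl
    convert this using 1
    · rfl
    · simp [f', sum_apply]
  have hsum : ∀ k, 0 ≤ ∑ j, C k j := fun k => Finset.sum_nonneg fun j _ =>
    (norm_nonneg _).trans (hC k j p (Metric.mem_closedBall_self hr.le))
  have hbound : ∀ t ∈ Set.Ico (0 : ℝ) 1, ‖f' t‖ ≤ ((∑ k, ∑ j, C k j) * r) * ‖f t‖ := by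
    intro t ht
    have hx' : ‖x - p‖ ≤ r := mem_closedBall_iff_norm.1 hx
    refine (pi_norm_le_iff_of_nonneg (mul_nonneg (mul_nonneg
      (Finset.sum_nonneg fun k _ => hsum k) hr.le) (norm_nonneg _))).2 fun k => ?_
    calc ‖f' t k‖ ≤ ∑ j, ‖f t‖ * (C k j * r) := by
          refine norm_sum_le_of_le _ fun j _ => ?_
          rw [norm_mul]
          refine mul_le_mul (norm_le_pi_norm (f t) j) ?_ (norm_nonneg _) (norm_nonneg _)
          refine ((N k j _).le_opNorm _).trans ?_
          exact mul_le_mul (hC k j _ (hseg t ⟨ht.1, ht.2.le⟩)) hx' (norm_nonneg _)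
            ((norm_nonneg _).trans (hC k j _ (hseg t ⟨ht.1, ht.2.le⟩)))
      _ = ((∑ j, C k j) * r) * ‖f t‖ := by
          rw [← Finset.mul_sum, ← Finset.sum_mul, mul_comm]
      _ ≤ _ := by
          refine mul_le_mul_of_nonneg_right (mul_le_mul_of_nonneg_right ?_ hr.le) (norm_nonneg _)
          exact Finset.single_le_sum (f := fun k => ∑ j, C k j) (fun k _ => hsum k)
            (Finset.mem_univ k)
  have hz := eq_zero_of_abs_deriv_le_mul_abs_self_of_eq_zero_right
    (fun t ht => (hf t ht).continuousAt.continuousWithinAt)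
    (fun t ht => (hf t ⟨ht.1, ht.2.le⟩).hasDerivWithinAt)
    (by ext k; simp [f, h0]) hbound 1 ⟨zero_le_one, le_rfl⟩
  intro k
  simpa [f] using congrFun hz k

/-- Solutions of the abelian system are determined near a point by the values of the fibre
coordinates there. -/
theorem eventually_eq_zero_of_coords {U : Set (ℝ × ℝ)} {ω₁ ω₂ : OneForm} (h : IsCoframe U ω₁ ω₂)
    {a b : ℝ} (ha0 : a ≠ 0) (hb0 : b ≠ 0) (ha : a ≠ 1) (hb : b ≠ 1) (hab : a ≠ b)
    {w u v : SmoothFn U}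
    (hs : ∀ j, h.calculus.system (SmoothFn.const U a) (SmoothFn.const U b) w u v j = 0)
    {p : ℝ × ℝ} (hp : p ∈ U) (h0 : ∀ i, SmoothFn.eval hp (h.calculus.coords w u v i) = 0) :
    ∀ᶠ x in 𝓝 p, ∀ i, SmoothFn.rep (h.calculus.coords w u v i) x = 0 := by
  set y := h.calculus.coords w u v with hy
  -- Modulo the ideal generated by the six coordinates, the solution has zero 3-jet by
  -- `jets_vanish`. Lifted back, each derivative of a coordinate is a combination of the coordinates
  -- with smooth coefficients: the desired total linear system.
  let π := Ideal.Quotient.mk (Ideal.span (Set.range y))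
  have hy0 : ∀ i, π (y i) = 0 := fun i =>
    Ideal.Quotient.eq_zero_iff_mem.2 (Ideal.subset_span ⟨i, rfl⟩)
  have hu : ∀ c : ℝ, c ≠ 0 → IsUnit (π (SmoothFn.const U c)) := fun c hc =>
    SmoothFn.isUnit_map_const π hc
  have hz : ∀ i k, h.calculus.D i k 0 = 0 := fun i k => WeightedCalculus.D_zero i k
  have hsub : ∀ c d : ℝ, c ≠ d → IsUnit (π (SmoothFn.const U c) - π (SmoothFn.const U d)) :=
    fun c d hcd => by
      rw [← map_sub, ← SmoothFn.const_sub]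
      exact hu _ (sub_ne_zero.2 hcd)
  have hsub1 : ∀ c : ℝ, c ≠ 1 → IsUnit (π (SmoothFn.const U c) - 1) := fun c hc => by
    have := hsub c 1 hc
    rwa [SmoothFn.const_one, map_one] at this
  obtain ⟨jw, ju, jv⟩ := WeightedCalculus.jets_vanish π (h.isConst_const a) (h.isConst_const b)
    (hu a ha0) (hu b hb0) (hsub1 a ha) (hsub1 b hb) (hsub a b hab)
    (fun j => by rw [hs, map_zero]) (fun i j => by rw [hs, hz, map_zero])
    (fun j => by rw [hs, hz, hz, map_zero]) (fun j => by rw [hs, hz, hz, map_zero])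
    (fun j => by rw [hs, hz, hz, map_zero]) hy0
  -- The weights of `w₂₂, w₂, v₂, w, u, v`.
  let m : Fin 6 → ℕ := ![3, 2, 2, 1, 1, 1]
  have hD : ∀ i k, π (h.calculus.D i (m k) (y k)) = 0 := by
    intro i k
    fin_cases k
    · exact jw.three i 1 1
    · exact jw.two i 1
    · exact jv.two i 1
    · exact jw.one i
    · exact ju.one i
    · exact jv.one i
  have hM : ∀ i k, ∃ c : Fin 6 → SmoothFn U, ∑ j, c j * y j = h.calculus.D i (m k) (y k) :=
    fun i k => Ideal.mem_span_range_iff_exists_fun.1 (Ideal.Quotient.eq_zero_iff_mem.1 (hD i k))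
  choose M hM using hM
  have hcov : ∀ i k, ∀ x ∈ U, covD ω₁ ω₂ i (m k) (SmoothFn.rep (y k)) x =
      ∑ j, SmoothFn.rep (M i k j) x * SmoothFn.rep (y j) x := by
    intro i k x hx
    have e := congrArg (SmoothFn.eval hx) (hM i k)
    rw [map_sum] at e
    simp only [map_mul, SmoothFn.eval_eq] at e
    rw [e]
    exact (SmoothFn.rep_mk (h.smooth_covD (SmoothFn.smooth_rep (y k)) i (m k)) hx).symm
  -- Passing from `δᵢ` to `∂ᵢ` adds the weight times `gᵢ` on the diagonal.
  let P : Fin 2 → Fin 6 → Fin 6 → ℝ × ℝ → ℝ := fun i k j x =>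
    SmoothFn.rep (M i k j) x + (if j = k then (m k : ℝ) else 0) * connCoeff ω₁ ω₂ i x
  have sP : ∀ i k j, ContDiffOn ℝ ∞ (P i k j) U := fun i k j =>
    (SmoothFn.smooth_rep (M i k j)).add (contDiffOn_const.mul (h.smooth_connCoeff i))
  have hP : ∀ i k, ∀ x ∈ U, fderiv ℝ (SmoothFn.rep (y k)) x (frame ω₁ ω₂ i x) =
      ∑ j, SmoothFn.rep (y j) x * P i k j x := by
    intro i k x hx
    have e := hcov i k x hx
    simp only [covD] at e
    rw [sub_eq_iff_eq_add.1 e]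
    simp only [P, mul_add, Finset.sum_add_distrib, ite_mul, zero_mul, mul_ite, mul_zero,
      Finset.sum_ite_eq', Finset.mem_univ, if_true]
    congr 1
    · exact Finset.sum_congr rfl fun j _ => mul_comm _ _
    · ring
  refine eventually_eq_zero_of_fderiv_eq h.isOpen
    (N := fun k j x => P 0 k j x • ω₁ x + P 1 k j x • ω₂ x) (fun k x hx => ?_) (fun k j => ?_) hp
    (fun k => by rw [← SmoothFn.eval_eq hp, h0])
  · have key : fderiv ℝ (SmoothFn.rep (y k)) x =
        ∑ j, SmoothFn.rep (y j) x • (P 0 k j x • ω₁ x + P 1 k j x • ω₂ x) := by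
      rw [h.form_eq (fderiv ℝ (SmoothFn.rep (y k))) hx, hP 0 k x hx, hP 1 k x hx]
      simp only [smul_add, Finset.sum_add_distrib, Finset.sum_smul, smul_smul]
    rw [← key]
    exact (h.differentiableAt (SmoothFn.smooth_rep (y k)) hx).hasFDerivAt
  · exact (((sP 0 k j).smul h.smooth_one).add ((sP 1 k j).smul h.smooth_two)).continuousOn

/-! ## Germs of solutions of the abelian equation -/

/-- A 5-web with constant basic invariants `a, b` and smooth factors `s i` that normalize it. -/
structure IsNormalizedWeb (D : Set (ℝ × ℝ)) (W : Fin 5 → OneForm) (s : Fin 5 → ℝ × ℝ → ℝ)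
    (a b : ℝ) : Prop where
  isWeb : IsWeb D W
  smooth : ∀ i, ContDiffOn ℝ ∞ (s i) D
  ne_zero : ∀ i, ∀ q ∈ D, s i q ≠ 0
  isNormalization : IsNormalization D W (fun i q => s i q • W i q) (fun _ => a) (fun _ => b)

/-- The `i`-th component of a solution with respect to the scaled forms `s i • W i`. -/
def component (s : Fin 5 → ℝ × ℝ → ℝ) (lam : ℝ × ℝ → Fin 5 → ℝ) (i : Fin 5) (q : ℝ × ℝ) : ℝ :=
  lam q i / s i q

/-- The fibre coordinates `w₂₂, w₂, v₂, w, u, v` of a solution at a point. -/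
def solutionCoords (W : Fin 5 → OneForm) (s : Fin 5 → ℝ × ℝ → ℝ) (lam : ℝ × ℝ → Fin 5 → ℝ)
    (q : ℝ × ℝ) : Fin 6 → ℝ :=
  let δ := covD (fun q => s 0 q • W 0 q) (fun q => s 1 q • W 1 q) 1
  ![δ 2 (δ 1 (component s lam 2)) q, δ 1 (component s lam 2) q, δ 1 (component s lam 4) q,
    component s lam 2 q, component s lam 3 q, component s lam 4 q]

theorem covD_eventuallyEq {f g : ℝ × ℝ → ℝ} {p : ℝ × ℝ} (h : f =ᶠ[𝓝 p] g) (ω₁ ω₂ : OneForm)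
    (i : Fin 2) (k : ℕ) : covD ω₁ ω₂ i k f =ᶠ[𝓝 p] covD ω₁ ω₂ i k g := by
  filter_upwards [h, h.fderiv (𝕜 := ℝ)] with x h1 h2
  simp only [covD, h1, h2]

theorem solutionCoords_congr (W : Fin 5 → OneForm) (s : Fin 5 → ℝ × ℝ → ℝ)
    {lam mu : ℝ × ℝ → Fin 5 → ℝ} {p : ℝ × ℝ} (h : lam =ᶠ[𝓝 p] mu) :
    solutionCoords W s lam p = solutionCoords W s mu p := by
  have hc : ∀ i, component s lam i =ᶠ[𝓝 p] component s mu i := fun i => by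
    filter_upwards [h] with x hx
    simp only [component, hx]
  simp only [solutionCoords]
  rw [(covD_eventuallyEq (covD_eventuallyEq (hc 2) _ _ 1 1) _ _ 1 2).eq_of_nhds,
    (covD_eventuallyEq (hc 2) _ _ 1 1).eq_of_nhds, (covD_eventuallyEq (hc 4) _ _ 1 1).eq_of_nhds,
    (hc 2).eq_of_nhds, (hc 3).eq_of_nhds, (hc 4).eq_of_nhds]

namespace IsNormalizedWeb

variable {D V : Set (ℝ × ℝ)} {W : Fin 5 → OneForm} {s : Fin 5 → ℝ × ℝ → ℝ} {a b : ℝ}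
  (hn : IsNormalizedWeb D W s a b)

include hn

theorem isCoframe (hV : IsOpen V) (hVD : V ⊆ D) :
    IsCoframe V (fun q => s 0 q • W 0 q) (fun q => s 1 q • W 1 q) :=
  (hn.isNormalization.isCoframe hn.isWeb hn.isWeb.isOpen subset_rfl).mono hV hVD

theorem smooth_component (hVD : V ⊆ D) {lam : ℝ × ℝ → Fin 5 → ℝ} (hl : ContDiffOn ℝ ∞ lam V)
    (i : Fin 5) : ContDiffOn ℝ ∞ (component s lam i) V :=
  (contDiffOn_pi.1 hl i).div ((hn.smooth i).mono hVD) fun q hq => hn.ne_zero i q (hVD hq)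

/-- The triple `w, u, v` of smooth functions that represents a solution. -/
def triple (hVD : V ⊆ D) {lam : ℝ × ℝ → Fin 5 → ℝ} (hl : ContDiffOn ℝ ∞ lam V) (i : Fin 5) :
    SmoothFn V := SmoothFn.mk (component s lam i) (hn.smooth_component hVD hl i)

theorem smul_eq_component_smul {q : ℝ × ℝ} (hq : q ∈ D) (lam : ℝ × ℝ → Fin 5 → ℝ) (i : Fin 5) :
    lam q i • W i q = component s lam i q • (s i q • W i q) := by
  rw [smul_smul, component, div_mul_cancel₀ _ (hn.ne_zero i q hq)]

/-- Substituting the normalizing relations into the abelian equation and wedging with `ω₁` picks out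
the coefficient of `ω₂`. -/
theorem component_one (hVD : V ⊆ D) {lam : ℝ × ℝ → Fin 5 → ℝ} (hl : IsAbelianSolution W V lam)
    {q : ℝ × ℝ} (hq : q ∈ V) : component s lam 1 q =
      component s lam 2 q + component s lam 3 q + component s lam 4 q := by
  have hN := hn.isNormalization
  have e := hl.sum_eq_zero q hq
  rw [Fin.sum_univ_five] at e
  simp only [hn.smul_eq_component_smul (hVD hq)] at e
  have e2 := hN.theta_two (hVD hq)
  have e3 := hN.theta_three (hVD hq)
  have e4 := hN.theta_four (hVD hq)
  have hw := hN.wedge_ne_zero hn.isWeb subset_rfl (hVD hq) (i := 0) (j := 1) (by decide)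
  rw [e2, e3, e4] at e
  have f1 := congrArg (fun α : ℝ × ℝ →L[ℝ] ℝ => α (1, 0)) e
  have f2 := congrArg (fun α : ℝ × ℝ →L[ℝ] ℝ => α (0, 1)) e
  simp only [add_apply, smul_apply, neg_apply, smul_eq_mul, zero_apply] at f1 f2
  simp only [wedge, smul_apply, smul_eq_mul] at hw
  refine sub_eq_zero.1 ((mul_eq_zero.1 ?_).resolve_right hw)
  linear_combination (s 0 q * W 0 q (1, 0)) * f2 - (s 0 q * W 0 q (0, 1)) * f1

/-- Since `d(f ω₁) = -δ₂f ω₁ ∧ ω₂` and `d(f ω₂) = δ₁f ω₁ ∧ ω₂`, closedness of `f (c ω₁ + ω₂)` says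
`δ₁f - δ₂(c f) = 0`. The cases `c = 1, a, b` are the first three equations; closedness of `(w + u +
v) ω₂` is the fourth. -/
theorem system_triple (hV : IsOpen V) (hVD : V ⊆ D) {lam : ℝ × ℝ → Fin 5 → ℝ}
    (hl : IsAbelianSolution W V lam) (j : Fin 4) :
    (hn.isCoframe hV hVD).calculus.system (SmoothFn.const V a) (SmoothFn.const V b)
      (hn.triple hVD hl.smooth 2) (hn.triple hVD hl.smooth 3) (hn.triple hVD hl.smooth 4) j = 0 := by
  have hN := hn.isNormalization
  have hc := hn.isCoframe hV hVD
  have sm := hn.smooth_component hVD hl.smooth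
  refine (hc.system_mk a b (sm 2) (sm 3) (sm 4) j).trans
    (Subtype.ext (funext fun ⟨q, hq⟩ => ?_))
  change abelianSystem _ _ _ _ _ _ _ j q = 0
  have hw := hc.wedge_ne_zero q hq
  have closed : ∀ i, dForm (fun x => component s lam i x • (s i x • W i x)) q = 0 := fun i => by
    rw [← (hl.closed i).2 q hq]
    exact dForm_congr hV (fun x hx => (hn.smul_eq_component_smul (hVD hx) lam i).symm) hq
  have key : ∀ (i : Fin 5) (c : ℝ),
      (∀ x ∈ V, s i x • W i x = -(c • (s 0 x • W 0 x) + s 1 x • W 1 x)) →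
      Delta (fun q => s 0 q • W 0 q) (fun q => s 1 q • W 1 q) (fun _ => c) 1
        (component s lam i) q = 0 := by
    intro i c hi
    have sn := sm i
    have sc : ContDiffOn ℝ ∞ (fun x => c * component s lam i x) V := contDiffOn_const.mul sn
    have e := ((hl.closed i).smul hV (-1)).2 q hq
    have e1 : dForm (fun x => (c * component s lam i x) • (s 0 x • W 0 x) +
        component s lam i x • (s 1 x • W 1 x)) q =
        dForm (fun x => (c * component s lam i x) • (s 0 x • W 0 x)) q +
        dForm (fun x => component s lam i x • (s 1 x • W 1 x)) q :=
      dForm_add hV (sc.smul hc.smooth_one) (sn.smul hc.smooth_two) hq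
    rw [dForm_congr hV (θ := fun x => (c * component s lam i x) • (s 0 x • W 0 x) +
        component s lam i x • (s 1 x • W 1 x)) (fun x hx => ?_) hq, e1, hc.dForm_smul_one sc hq,
        hc.dForm_smul_two sn hq, ← add_mul] at e
    · rw [← (mul_eq_zero.1 e).resolve_right hw, Delta]
      ring
    · simp only [hn.smul_eq_component_smul (hVD hx) lam i, hi x hx]
      apply clm_eq_of_coeffs <;> simp only [add_apply, smul_apply, neg_apply, smul_eq_mul] <;> ring
  fin_cases j
  · refine key 2 1 fun x hx => ?_
    rw [one_smul]
    exact hN.theta_two (hVD hx)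
  · exact key 3 a fun x hx => hN.theta_three (hVD hx)
  · exact key 4 b fun x hx => hN.theta_four (hVD hx)
  · have e := closed 1
    rw [hc.dForm_smul_two (sm 1) hq] at e
    have e' := (mul_eq_zero.1 e).resolve_right hw
    rw [hc.covD_congr (fun x hx => hn.component_one hVD hl hx) 0 1 hq,
      hc.covD_add ((sm 2).add (sm 3)) (sm 4) 0 1 hq, hc.covD_add (sm 2) (sm 3) 0 1 hq] at e'
    exact e'

theorem eval_coords_triple (hV : IsOpen V) (hVD : V ⊆ D) {lam : ℝ × ℝ → Fin 5 → ℝ}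
    (hl : ContDiffOn ℝ ∞ lam V) {q : ℝ × ℝ} (hq : q ∈ V) (i : Fin 6) :
    SmoothFn.eval hq ((hn.isCoframe hV hVD).calculus.coords
      (hn.triple hVD hl 2) (hn.triple hVD hl 3) (hn.triple hVD hl 4) i) =
      solutionCoords W s lam q i := by
  fin_cases i <;>
    simp only [WeightedCalculus.coords, triple, IsCoframe.D_mk, Fin.reduceFinMk, Matrix.cons_val,
      Fin.zero_eta, Fin.mk_one] <;> rfl

theorem solutionCoords_add (hV : IsOpen V) (hVD : V ⊆ D) {lam mu : ℝ × ℝ → Fin 5 → ℝ}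
    (hl : ContDiffOn ℝ ∞ lam V) (hm : ContDiffOn ℝ ∞ mu V) {q : ℝ × ℝ} (hq : q ∈ V) :
    solutionCoords W s (lam + mu) q = solutionCoords W s lam q + solutionCoords W s mu q := by
  funext i
  have hlm : ContDiffOn ℝ ∞ (lam + mu) V := hl.add hm
  have e : ∀ i, hn.triple hVD hlm i = hn.triple hVD hl i + hn.triple hVD hm i := fun i =>
    Subtype.ext (funext fun x => add_div _ _ _)
  rw [Pi.add_apply, ← hn.eval_coords_triple hV hVD hl hq, ← hn.eval_coords_triple hV hVD hm hq,
    ← hn.eval_coords_triple hV hVD hlm hq, ← map_add, e, e, e, WeightedCalculus.coords_add]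

theorem solutionCoords_smul (hV : IsOpen V) (hVD : V ⊆ D) (c : ℝ) {lam : ℝ × ℝ → Fin 5 → ℝ}
    (hl : ContDiffOn ℝ ∞ lam V) {q : ℝ × ℝ} (hq : q ∈ V) :
    solutionCoords W s (c • lam) q = c • solutionCoords W s lam q := by
  funext i
  have hl' : ContDiffOn ℝ ∞ (c • lam) V := hl.const_smul c
  have e : ∀ i, hn.triple hVD hl' i = SmoothFn.const V c * hn.triple hVD hl i := fun i =>
    Subtype.ext (funext fun x => mul_div_assoc _ _ _)
  rw [Pi.smul_apply, ← hn.eval_coords_triple hV hVD hl hq, ← hn.eval_coords_triple hV hVD hl' hq,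
    e, e, e, WeightedCalculus.coords_const_mul ((hn.isCoframe hV hVD).isConst_const c), map_mul]
  rfl

/-- The total linear system makes `w, u, v` vanish near `p`. The abelian equation then reduces to a
relation between two independent covectors, so the remaining components vanish too. -/
theorem eventually_eq_zero (hV : IsOpen V) (hVD : V ⊆ D) {lam : ℝ × ℝ → Fin 5 → ℝ}
    (hl : IsAbelianSolution W V lam) {p : ℝ × ℝ} (hp : p ∈ V)
    (h0 : solutionCoords W s lam p = 0) : lam =ᶠ[𝓝 p] 0 := by
  obtain ⟨a0, b0, a1, b1, hab⟩ := hn.isNormalization.nondegenerate hn.isWeb subset_rfl (hVD hp)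
  have hz := eventually_eq_zero_of_coords (hn.isCoframe hV hVD) a0 b0 a1 b1 hab
    (hn.system_triple hV hVD hl) hp
    (fun i => by rw [hn.eval_coords_triple hV hVD hl.smooth hp, h0, Pi.zero_apply])
  filter_upwards [hz, hV.mem_nhds hp] with x hx hxV
  have hc : ∀ i, solutionCoords W s lam x i = 0 := fun i => by
    rw [← hn.eval_coords_triple hV hVD hl.smooth hxV, SmoothFn.eval_eq, hx]
  have hlam : ∀ i, component s lam i x = 0 → lam x i = 0 := fun i h =>
    (div_eq_zero_iff.1 h).resolve_right (hn.ne_zero i x (hVD hxV))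
  have l2 := hlam 2 (hc 3)
  have l3 := hlam 3 (hc 4)
  have l4 := hlam 4 (hc 5)
  have e := hl.sum_eq_zero x hxV
  rw [Fin.sum_univ_five, l2, l3, l4, zero_smul, zero_smul, zero_smul, add_zero, add_zero,
    add_zero] at e
  have l01 := LinearIndependent.pair_iff.1 (hn.isWeb.transversal x (hVD hxV) 0 1 (by decide)) _ _ e
  funext i
  fin_cases i
  exacts [l01.1, l01.2, l2, l3, l4]

/-- A solution germ is given by a solution on an open subset of `D`. -/
theorem exists_solution {p : ℝ × ℝ} (hp : p ∈ D) (g : solutionGerms W p) :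
    ∃ V : Set (ℝ × ℝ), IsOpen V ∧ V ⊆ D ∧ p ∈ V ∧ ∃ lam : ℝ × ℝ → Fin 5 → ℝ,
      IsAbelianSolution W V lam ∧ (lam : (𝓝 p).Germ (Fin 5 → ℝ)) = g := by
  obtain ⟨U, hU, hpU, lam, hl, e⟩ := g.2
  exact ⟨U ∩ D, hU.inter hn.isWeb.isOpen, Set.inter_subset_right, ⟨hpU, hp⟩, lam,
    hl.mono Set.inter_subset_left, e⟩

/-- The fibre coordinates at `p` as a linear map on solution germs. -/
def germCoords {p : ℝ × ℝ} (hp : p ∈ D) : solutionGerms W p →ₗ[ℝ] Fin 6 → ℝ where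
  toFun g := solutionCoords W s (hn.exists_solution hp g).choose_spec.2.2.2.choose p
  map_add' g g' := by
    obtain ⟨-, -, -, h3⟩ := (hn.exists_solution hp (g + g')).choose_spec
    obtain ⟨hV, hVD, hpV, h1⟩ := (hn.exists_solution hp g).choose_spec
    obtain ⟨hV', hVD', hpV', h2⟩ := (hn.exists_solution hp g').choose_spec
    have hV₀ := hV.inter hV'
    rw [← hn.solutionCoords_add hV₀ (Set.inter_subset_left.trans hVD)
      (h1.choose_spec.1.smooth.mono Set.inter_subset_left)
      (h2.choose_spec.1.smooth.mono Set.inter_subset_right) ⟨hpV, hpV'⟩]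
    refine solutionCoords_congr W s (Filter.Germ.coe_eq.1 ?_)
    rw [h3.choose_spec.2, Filter.Germ.coe_add, h1.choose_spec.2, h2.choose_spec.2]
    rfl
  map_smul' c g := by
    obtain ⟨-, -, -, h3⟩ := (hn.exists_solution hp (c • g)).choose_spec
    obtain ⟨hV, hVD, hpV, h1⟩ := (hn.exists_solution hp g).choose_spec
    rw [RingHom.id_apply, ← hn.solutionCoords_smul hV hVD c h1.choose_spec.1.smooth hpV]
    refine solutionCoords_congr W s (Filter.Germ.coe_eq.1 ?_)
    rw [h3.choose_spec.2, Filter.Germ.coe_smul, h1.choose_spec.2]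
    rfl

/-- The coordinates depend only on the germ, so the representative chosen in `germCoords` may be
replaced by any other. -/
theorem germCoords_coe {p : ℝ × ℝ} (hp : p ∈ D) (g : solutionGerms W p)
    {lam : ℝ × ℝ → Fin 5 → ℝ} (h : (lam : (𝓝 p).Germ (Fin 5 → ℝ)) = g) :
    hn.germCoords hp g = solutionCoords W s lam p :=
  solutionCoords_congr W s (Filter.Germ.coe_eq.1
    ((hn.exists_solution hp g).choose_spec.2.2.2.choose_spec.2.trans h.symm))

theorem germCoords_injective {p : ℝ × ℝ} (hp : p ∈ D) :
    Function.Injective (hn.germCoords hp) := by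
  refine (injective_iff_map_eq_zero _).2 fun g hg => ?_
  obtain ⟨V, hV, hVD, hpV, lam, hl, e⟩ := hn.exists_solution hp g
  rw [hn.germCoords_coe hp g e] at hg
  refine Subtype.ext ?_
  rw [← e]
  exact Filter.Germ.coe_eq.2 (hn.eventually_eq_zero hV hVD hl hpV hg)

theorem finite_solutionGerms {p : ℝ × ℝ} (hp : p ∈ D) : Module.Finite ℝ (solutionGerms W p) :=
  Module.Finite.of_injective _ (hn.germCoords_injective hp)

theorem rankAt_le {p : ℝ × ℝ} (hp : p ∈ D) : rankAt W p ≤ 6 := by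
  have := LinearMap.finrank_le_finrank_of_injective (hn.germCoords_injective hp)
  rwa [Module.finrank_fin_fun] at this

end IsNormalizedWeb

/-! ## Maximum rank forces flatness -/

/-- At maximum rank the curvature vanishes nearby. -/
theorem IsNormalizedWeb.curvature_eventually_eq_zero {D : Set (ℝ × ℝ)} {W : Fin 5 → OneForm}
    {s : Fin 5 → ℝ × ℝ → ℝ} {a b : ℝ} (hn : IsNormalizedWeb D W s a b) {p : ℝ × ℝ} (hp : p ∈ D)
    (hr : rankAt W p = 6) :
    ∀ᶠ q in 𝓝 p, curvature (fun q => s 0 q • W 0 q) (fun q => s 1 q • W 1 q) q = 0 := by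
  have := hn.finite_solutionGerms hp
  have hsurj : Function.Surjective (hn.germCoords hp) :=
    (LinearMap.injective_iff_surjective_of_finrank_eq_finrank
      (hr.trans (Module.finrank_fin_fun ℝ).symm)).1 (hn.germCoords_injective hp)
  choose g hg using fun i : Fin 6 => hsurj (Pi.single i 1)
  choose V hV hVD hpV lam hl e using fun i => hn.exists_solution hp (g i)
  let V₀ := ⋂ i, V i
  have hV₀ : IsOpen V₀ := isOpen_iInter_of_finite hV
  have hp₀ : p ∈ V₀ := Set.mem_iInter.2 hpV
  have hV₀D : V₀ ⊆ D := (Set.iInter_subset _ 0).trans (hVD 0)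
  have hl₀ : ∀ i, IsAbelianSolution W V₀ (lam i) := fun i => (hl i).mono (Set.iInter_subset _ i)
  -- The rows are the coordinates of six solutions, chosen so that `M p = 1`. By continuity `M q`
  -- stays invertible near `p`.
  let M : ℝ × ℝ → Matrix (Fin 6) (Fin 6) ℝ := fun q i j => solutionCoords W s (lam i) q j
  have hM : ContinuousOn M V₀ := by
    refine continuousOn_pi.2 fun i => continuousOn_pi.2 fun j => ?_
    refine (SmoothFn.smooth_rep ((hn.isCoframe hV₀ hV₀D).calculus.coords
      (hn.triple hV₀D (hl₀ i).smooth 2) (hn.triple hV₀D (hl₀ i).smooth 3)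
      (hn.triple hV₀D (hl₀ i).smooth 4) j)).continuousOn.congr fun q hq => ?_
    rw [← SmoothFn.eval_eq hq, hn.eval_coords_triple hV₀ hV₀D]
  have hMp : M p = 1 := by
    ext i j
    have e1 := hn.germCoords_coe hp (g i) (e i)
    rw [hg] at e1
    rw [Matrix.one_apply, show M p i j = solutionCoords W s (lam i) p j from rfl, ← e1,
      Pi.single_apply]
    simp only [eq_comm]
  have hdet : ContinuousAt (fun q => (M q).det) p :=
    have hd : Continuous fun A : Matrix (Fin 6) (Fin 6) ℝ => A.det := continuous_id.matrix_det
    (hd.tendsto (M p)).comp (hM.continuousAt (hV₀.mem_nhds hp₀))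
  have hne : ∀ᶠ q in 𝓝 p, (M q).det ≠ 0 := hdet.eventually_ne (by simp [hMp])
  filter_upwards [hne, hV₀.mem_nhds hp₀] with q hq hqV
  obtain ⟨-, -, a1, b1, -⟩ := hn.isNormalization.nondegenerate hn.isWeb subset_rfl (hV₀D hqV)
  have hc := hn.isCoframe hV₀ hV₀D
  set c := obstructionCoeff (fun q => s 0 q • W 0 q) (fun q => s 1 q • W 1 q) a b q
  -- On a solution the multi-bracket is zero, so the obstruction vector is orthogonal to every row
  -- of `M q`.
  have hz : ∀ i, ∑ j, c j * solutionCoords W s (lam i) q j = 0 := by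
    intro i
    have hs := hn.system_triple hV₀ hV₀D (hl₀ i)
    have e1 := eval_bracket hc hqV a1 b1 (fun j => by rw [hs, map_zero])
      (fun k j => by rw [hs, WeightedCalculus.D_zero, map_zero])
    rw [WeightedCalculus.bracket_eq_zero hs, map_zero] at e1
    have hne : -10 * (a - 1) * (b - 1) ≠ 0 :=
      mul_ne_zero (mul_ne_zero (by norm_num) (sub_ne_zero.2 a1)) (sub_ne_zero.2 b1)
    have e2 := (mul_eq_zero.1 e1.symm).resolve_left hne
    simpa only [hn.eval_coords_triple hV₀ hV₀D (hl₀ i).smooth hqV] using e2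
  have hz' : (M q).mulVec c = 0 := funext fun i => by
    rw [Pi.zero_apply, ← hz i]
    simp only [Matrix.mulVec, dotProduct]
    exact Finset.sum_congr rfl fun j _ => mul_comm (M q i j) (c j)
  exact congrFun (Matrix.eq_zero_of_mulVec_eq_zero hq hz') 0

/-! ## Flat webs are parallelizable -/

/-- A smooth closed 1-form on an open convex set has a smooth primitive. -/
theorem exists_primitive {η : OneForm} {B : Set (ℝ × ℝ)} (hB : IsOpen B) (hc : Convex ℝ B)
    (h : IsClosedFormOn η B) :
    ∃ f : ℝ × ℝ → ℝ, ContDiffOn ℝ ∞ f B ∧ ∀ x ∈ B, HasFDerivAt f (η x) x := by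
  have hd : ∀ x ∈ B, DifferentiableAt ℝ η x := fun x hx =>
    (h.1.contDiffAt (hB.mem_nhds hx)).differentiableAt (by simp)
  obtain ⟨f, hf⟩ := hc.exists_forall_hasFDerivAt_of_fderiv_symmetric hB
    (fun x hx => (hd x hx).differentiableWithinAt) (fun x hx u v => by
      have e := h.2 x hx
      simp only [dForm] at e
      rw [fderiv_clm_apply (hd x hx) (differentiableAt_const _),
        fderiv_clm_apply (hd x hx) (differentiableAt_const _)] at e
      simp at e
      have hu : ∀ w : ℝ × ℝ, w = w.1 • ((1 : ℝ), (0 : ℝ)) + w.2 • ((0 : ℝ), (1 : ℝ)) := fun w => by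
        simp
      rw [hu u, hu v]
      simp only [map_add, map_smul, add_apply, smul_apply, smul_eq_mul]
      linear_combination (u.1 * v.2 - u.2 * v.1) * e)
  refine ⟨f, ?_, hf⟩
  refine (contDiffOn_infty_iff_fderiv_of_isOpen hB).2
    ⟨fun x hx => (hf x hx).differentiableAt.differentiableWithinAt, ?_⟩
  exact h.1.congr fun x hx => (hf x hx).fderiv

/-- With `df = γ` one has `d(exp f ωᵢ) = exp f (γ ∧ ωᵢ + ωᵢ ∧ γ) = 0`; the primitive `f` exists
since `dγ = K ω₁ ∧ ω₂ = 0` on a convex set. -/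
theorem IsCoframe.exists_closed_multiples {B : Set (ℝ × ℝ)} {ω₁ ω₂ : OneForm}
    (h : IsCoframe B ω₁ ω₂) (hc : Convex ℝ B) (hK : ∀ q ∈ B, curvature ω₁ ω₂ q = 0) :
    ∃ f : ℝ × ℝ → ℝ, ContDiffOn ℝ ∞ f B ∧
      IsClosedFormOn (fun q => Real.exp (f q) • ω₁ q) B ∧
      IsClosedFormOn (fun q => Real.exp (f q) • ω₂ q) B := by
  obtain ⟨f, hf, hf'⟩ := exists_primitive h.isOpen hc (η := connForm ω₁ ω₂)
    ⟨h.smooth_connForm, fun q hq =>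
      (div_eq_zero_iff.1 (hK q hq)).resolve_right (h.wedge_ne_zero q hq)⟩
  have he : ContDiffOn ℝ ∞ (fun q => Real.exp (f q)) B := hf.exp
  have hd : ∀ q ∈ B, fderiv ℝ (fun q => Real.exp (f q)) q = Real.exp (f q) • connForm ω₁ ω₂ q :=
    fun q hq => (hf' q hq).exp.fderiv
  refine ⟨f, hf, ⟨he.smul h.smooth_one, fun q hq => ?_⟩, ⟨he.smul h.smooth_two, fun q hq => ?_⟩⟩
  · rw [dForm_smul h.isOpen he h.smooth_one hq, h.dForm_one hq]
    simp only [wedge, hd q hq, connForm, add_apply, smul_apply, smul_eq_mul]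
    ring
  · rw [dForm_smul h.isOpen he h.smooth_two hq, h.dForm_two hq]
    simp only [wedge, hd q hq, connForm, add_apply, smul_apply, smul_eq_mul]
    ring

theorem exists_equiv_prod {α β : OneForm} {q : ℝ × ℝ} (h : wedge α β q ≠ 0) :
    ∃ e : (ℝ × ℝ) ≃L[ℝ] (ℝ × ℝ), (e : ℝ × ℝ →L[ℝ] ℝ × ℝ) = (α q).prod (β q) := by
  have hinj : Function.Injective ((α q).prod (β q)).toLinearMap := by
    refine (injective_iff_map_eq_zero _).2 fun v hv => ?_
    have h1 : α q v = 0 := congrArg Prod.fst hv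
    have h2 : β q v = 0 := congrArg Prod.snd hv
    have hu : v = v.1 • ((1 : ℝ), (0 : ℝ)) + v.2 • ((0 : ℝ), (1 : ℝ)) := by simp
    rw [hu, map_add, map_smul, map_smul, smul_eq_mul, smul_eq_mul] at h1 h2
    refine Prod.ext ((mul_eq_zero.1 ?_).resolve_left h) ((mul_eq_zero.1 ?_).resolve_left h)
    · simp only [wedge]
      linear_combination β q (0, 1) * h1 - α q (0, 1) * h2
    · simp only [wedge]
      linear_combination α q (1, 0) * h2 - β q (1, 0) * h1
  exact ⟨(LinearEquiv.ofInjectiveEndo _ hinj).toContinuousLinearEquiv, rfl⟩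

/-- Primitives `x, y` of `exp f • ω₁, exp f • ω₂` are local coordinates. Constancy of `a, b` makes
the other three foliations level sets of `x + y`, `a x + y`, `b x + y`. -/
theorem IsNormalizedWeb.isParallelizableAt {D : Set (ℝ × ℝ)} {W : Fin 5 → OneForm}
    {s : Fin 5 → ℝ × ℝ → ℝ} {a b : ℝ} (hn : IsNormalizedWeb D W s a b) {p : ℝ × ℝ} (hp : p ∈ D)
    (hK : ∀ᶠ q in 𝓝 p, curvature (fun q => s 0 q • W 0 q) (fun q => s 1 q • W 1 q) q = 0) :
    IsParallelizableAt D W p := by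
  obtain ⟨r, hr, hB⟩ := Metric.nhds_basis_ball.mem_iff.1
    (Filter.inter_mem hK (hn.isWeb.isOpen.mem_nhds hp))
  set B := Metric.ball p r
  have hBD : B ⊆ D := fun q hq => (hB hq).2
  have hpB : p ∈ B := Metric.mem_ball_self hr
  have hBo : IsOpen B := Metric.isOpen_ball
  have hc := hn.isCoframe hBo hBD
  obtain ⟨f, hf, hη₁, hη₂⟩ := hc.exists_closed_multiples (convex_ball p r) fun q hq => (hB hq).1
  obtain ⟨x, hx, hx'⟩ := exists_primitive hBo (convex_ball p r) hη₁
  obtain ⟨y, hy, hy'⟩ := exists_primitive hBo (convex_ball p r) hη₂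
  have hφs : ContDiffOn ℝ ∞ (fun q => (x q, y q)) B := hx.prodMk hy
  have hequiv : ∀ q ∈ B, ∃ e : (ℝ × ℝ) ≃L[ℝ] (ℝ × ℝ), HasFDerivAt (fun q => (x q, y q))
      (e : ℝ × ℝ →L[ℝ] ℝ × ℝ) q := fun q hq => by
    obtain ⟨e, he⟩ := exists_equiv_prod
      (α := fun q => Real.exp (f q) • s 0 q • W 0 q) (β := fun q => Real.exp (f q) • s 1 q • W 1 q)
      (q := q) (by
        rw [wedge_smul_smul (α := fun q => s 0 q • W 0 q) (β := fun q => s 1 q • W 1 q) rfl rfl]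
        exact mul_ne_zero (mul_ne_zero (Real.exp_ne_zero _) (Real.exp_ne_zero _))
          (hc.wedge_ne_zero q hq))
    exact ⟨e, by rw [he]; exact (hx' q hq).prodMk (hy' q hq)⟩
  have hat : ∀ q ∈ B, ContDiffAt ℝ ∞ (fun q => (x q, y q)) q := fun q hq =>
    hφs.contDiffAt (hBo.mem_nhds hq)
  obtain ⟨e₀, he₀⟩ := hequiv p hpB
  let φ := ((hat p hpB).toOpenPartialHomeomorph _ he₀ (by simp)).restrOpen B hBo
  have hφB : φ.source ⊆ B := Set.inter_subset_right
  have hφd : ∀ q ∈ φ.source, fderiv ℝ φ q =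
      (Real.exp (f q) • s 0 q • W 0 q).prod (Real.exp (f q) • s 1 q • W 1 q) := fun q hq =>
    ((hx' q (hφB hq)).prodMk (hy' q (hφB hq))).fderiv
  refine ⟨φ, ⟨(hat p hpB).mem_toOpenPartialHomeomorph_source he₀ (by simp), hpB⟩,
    hφB.trans hBD, hφs.mono hφB, fun z hz => ?_, ?_⟩
  · obtain ⟨e, he⟩ := hequiv (φ.symm z) (hφB (φ.map_target hz))
    exact (φ.contDiffAt_symm hz he (hat _ (hφB (φ.map_target hz)))).contDiffWithinAt
  · let ℓ : ℝ → ℝ → (ℝ × ℝ →L[ℝ] ℝ) := fun c d =>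
      c • ContinuousLinearMap.fst ℝ ℝ ℝ + d • ContinuousLinearMap.snd ℝ ℝ ℝ
    have hℓ : ∀ c d v, ℓ c d v = c * v.1 + d * v.2 := fun c d v => by simp [ℓ]
    have hd : ∀ c d, d ≠ 0 → ℓ c d ≠ 0 := fun c d hd h0 => by
      have := congrArg (fun m : ℝ × ℝ →L[ℝ] ℝ => m (0, 1)) h0
      simp only [hℓ] at this
      simp [hd] at this
    have hrel : ∀ (i : Fin 5) (c d : ℝ),
        (∀ q ∈ D, s i q • W i q = c • (s 0 q • W 0 q) + d • (s 1 q • W 1 q)) →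
        ∀ q ∈ φ.source, ∀ v, W i q v = 0 ↔ ℓ c d (fderiv ℝ φ q v) = 0 := by
      intro i c d hi q hq v
      have hqD := hBD (hφB hq)
      have e := congrArg (fun m : ℝ × ℝ →L[ℝ] ℝ => m v) (hi q hqD)
      simp only [add_apply, smul_apply, smul_eq_mul] at e
      have e' : ℓ c d (fderiv ℝ φ q v) = Real.exp (f q) * s i q * W i q v := by
        rw [hφd q hq, hℓ]
        simp only [ContinuousLinearMap.prod_apply, smul_apply, smul_eq_mul]
        linear_combination -Real.exp (f q) * e
      rw [e', mul_eq_zero_iff_left (mul_ne_zero (Real.exp_ne_zero _) (hn.ne_zero i q hqD))]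
    have hN := hn.isNormalization
    refine ⟨![ℓ 1 0, ℓ 0 1, ℓ (-1) (-1), ℓ (-a) (-1), ℓ (-b) (-1)], fun i => ?_, fun i => ?_⟩
    · fin_cases i
      · intro h0
        have := congrArg (fun m : ℝ × ℝ →L[ℝ] ℝ => m (1, 0)) h0
        simp [hℓ] at this
      all_goals exact hd _ _ (by norm_num)
    · fin_cases i
      · exact hrel 0 1 0 fun q _ => by simp
      · exact hrel 1 0 1 fun q _ => by simp
      · refine hrel 2 (-1) (-1) fun q hq => (hN.theta_two hq).trans ?_
        apply clm_eq_of_coeffs <;> simp only [add_apply, smul_apply, neg_apply, smul_eq_mul] <;> ring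
      · refine hrel 3 (-a) (-1) fun q hq => (hN.theta_three hq).trans ?_
        apply clm_eq_of_coeffs <;> simp only [add_apply, smul_apply, neg_apply, smul_eq_mul] <;> ring
      · refine hrel 4 (-b) (-1) fun q hq => (hN.theta_four hq).trans ?_
        apply clm_eq_of_coeffs <;> simp only [add_apply, smul_apply, neg_apply, smul_eq_mul] <;> ring

/-! ## Parallelizable webs have maximum rank -/

/-- The conditions on coefficients `c i k` for `∑ i, ∑ k, c i k (ℓ i) ^ k • ℓ i` to vanish, where
`ℓ i` has the coordinates `α i, β i`. -/
def momentMap {d : ℕ} (α β : Fin d → ℝ) : (Fin d → Fin 3 → ℝ) →ₗ[ℝ] (Fin 9 → ℝ) where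
  toFun c := ![∑ i, c i 0 * α i, ∑ i, c i 0 * β i,
    ∑ i, c i 1 * α i ^ 2, ∑ i, c i 1 * (α i * β i), ∑ i, c i 1 * β i ^ 2,
    ∑ i, c i 2 * α i ^ 3, ∑ i, c i 2 * (α i ^ 2 * β i), ∑ i, c i 2 * (α i * β i ^ 2),
    ∑ i, c i 2 * β i ^ 3]
  map_add' c e := by
    funext j
    fin_cases j <;> simp [add_mul, Finset.sum_add_distrib]
  map_smul' r c := by
    funext j
    fin_cases j <;> simp [Finset.mul_sum, mul_assoc]

/-- Fifteen unknowns, and `2 + 3 + 4 = 9` equations: one for each monomial of degree 1, 2 or 3 in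
two variables. -/
theorem six_le_finrank_ker_momentMap (α β : Fin 5 → ℝ) :
    6 ≤ Module.finrank ℝ (LinearMap.ker (momentMap α β)) := by
  have h1 := LinearMap.finrank_range_add_finrank_ker (momentMap α β)
  have h2 := Submodule.finrank_le (LinearMap.range (momentMap α β))
  have h3 : Module.finrank ℝ (Fin 5 → Fin 3 → ℝ) = 15 := by simp [Module.finrank_pi_fintype]
  rw [Module.finrank_fin_fun] at h2
  omega

/-- Viewed as a polynomial in `v`, the sum has coefficients that are multiples of the nine moments.
-/
theorem sum_eq_zero_of_mem_ker_momentMap {d : ℕ} {ℓ : Fin d → (ℝ × ℝ →L[ℝ] ℝ)}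
    {c : Fin d → Fin 3 → ℝ} (hc : momentMap (fun i => ℓ i (1, 0)) (fun i => ℓ i (0, 1)) c = 0)
    (v : ℝ × ℝ) : ∑ i, (c i 0 + c i 1 * ℓ i v + c i 2 * ℓ i v ^ 2) • ℓ i = 0 := by
  have h := congrFun hc
  have h0 : ∑ i, c i 0 * ℓ i (1, 0) = 0 := h 0
  have h1 : ∑ i, c i 0 * ℓ i (0, 1) = 0 := h 1
  have h2 : ∑ i, c i 1 * ℓ i (1, 0) ^ 2 = 0 := h 2
  have h3 : ∑ i, c i 1 * (ℓ i (1, 0) * ℓ i (0, 1)) = 0 := h 3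
  have h4 : ∑ i, c i 1 * ℓ i (0, 1) ^ 2 = 0 := h 4
  have h5 : ∑ i, c i 2 * ℓ i (1, 0) ^ 3 = 0 := h 5
  have h6 : ∑ i, c i 2 * (ℓ i (1, 0) ^ 2 * ℓ i (0, 1)) = 0 := h 6
  have h7 : ∑ i, c i 2 * (ℓ i (1, 0) * ℓ i (0, 1) ^ 2) = 0 := h 7
  have h8 : ∑ i, c i 2 * ℓ i (0, 1) ^ 3 = 0 := h 8
  have hv : ∀ i, ℓ i v = v.1 * ℓ i (1, 0) + v.2 * ℓ i (0, 1) := fun i => by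
    have hu : v = v.1 • ((1 : ℝ), (0 : ℝ)) + v.2 • ((0 : ℝ), (1 : ℝ)) := by simp
    conv_lhs => rw [hu]
    rw [map_add, map_smul, map_smul, smul_eq_mul, smul_eq_mul]
  apply clm_eq_of_coeffs
  · simp only [sum_apply, smul_apply, smul_eq_mul, zero_apply, hv]
    calc _ = ∑ i, c i 0 * ℓ i (1, 0) + v.1 * ∑ i, c i 1 * ℓ i (1, 0) ^ 2 +
          v.2 * ∑ i, c i 1 * (ℓ i (1, 0) * ℓ i (0, 1)) +
          v.1 ^ 2 * ∑ i, c i 2 * ℓ i (1, 0) ^ 3 +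
          2 * v.1 * v.2 * ∑ i, c i 2 * (ℓ i (1, 0) ^ 2 * ℓ i (0, 1)) +
          v.2 ^ 2 * ∑ i, c i 2 * (ℓ i (1, 0) * ℓ i (0, 1) ^ 2) := by
          simp only [Finset.mul_sum, ← Finset.sum_add_distrib]
          exact Finset.sum_congr rfl fun i _ => by ring
      _ = 0 := by rw [h0, h2, h3, h5, h6, h7]; ring
  · simp only [sum_apply, smul_apply, smul_eq_mul, zero_apply, hv]
    calc _ = ∑ i, c i 0 * ℓ i (0, 1) + v.1 * ∑ i, c i 1 * (ℓ i (1, 0) * ℓ i (0, 1)) +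
          v.2 * ∑ i, c i 1 * ℓ i (0, 1) ^ 2 +
          v.1 ^ 2 * ∑ i, c i 2 * (ℓ i (1, 0) ^ 2 * ℓ i (0, 1)) +
          2 * v.1 * v.2 * ∑ i, c i 2 * (ℓ i (1, 0) * ℓ i (0, 1) ^ 2) +
          v.2 ^ 2 * ∑ i, c i 2 * ℓ i (0, 1) ^ 3 := by
          simp only [Finset.mul_sum, ← Finset.sum_add_distrib]
          exact Finset.sum_congr rfl fun i _ => by ring
      _ = 0 := by rw [h1, h3, h4, h6, h7, h8]; ring

/-- The factor by which `η` is a multiple of `ξ`. -/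
def formRatio (η ξ : OneForm) (q : ℝ × ℝ) : ℝ :=
  (η q (1, 0) * ξ q (1, 0) + η q (0, 1) * ξ q (0, 1)) / (ξ q (1, 0) ^ 2 + ξ q (0, 1) ^ 2)

theorem coeffs_sq_ne_zero {ξ : OneForm} {q : ℝ × ℝ} (h : ξ q ≠ 0) :
    ξ q (1, 0) ^ 2 + ξ q (0, 1) ^ 2 ≠ 0 := fun h0 => h <| by
  apply clm_eq_of_coeffs
  · rw [zero_apply]
    nlinarith [sq_nonneg (ξ q (1, 0)), sq_nonneg (ξ q (0, 1))]
  · rw [zero_apply]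
    nlinarith [sq_nonneg (ξ q (1, 0)), sq_nonneg (ξ q (0, 1))]

theorem formRatio_smul {η ξ : OneForm} {q : ℝ × ℝ} (hξ : ξ q ≠ 0)
    (h : ∀ v, ξ q v = 0 → η q v = 0) : formRatio η ξ q • ξ q = η q := by
  have hne := coeffs_sq_ne_zero hξ
  have hs : ∀ (m : ℝ × ℝ →L[ℝ] ℝ) (x y : ℝ), m (x, y) = x * m (1, 0) + y * m (0, 1) :=
    fun m x y => by
      have hu : (x, y) = x • ((1 : ℝ), (0 : ℝ)) + y • ((0 : ℝ), (1 : ℝ)) := by simp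
      rw [hu, map_add, map_smul, map_smul, smul_eq_mul, smul_eq_mul]
  -- This vector spans the kernel of `ξ q`, so `η q` is proportional to `ξ q` and the projection
  -- formula of `formRatio` is exact.
  have e := h (-ξ q (0, 1), ξ q (1, 0)) (by rw [hs]; ring)
  rw [hs] at e
  apply clm_eq_of_coeffs
  · rw [smul_apply, smul_eq_mul, formRatio]
    field_simp
    linear_combination ξ q (0, 1) * e
  · rw [smul_apply, smul_eq_mul, formRatio]
    field_simp
    linear_combination -ξ q (1, 0) * e

theorem contDiffOn_formRatio {η ξ : OneForm} {V : Set (ℝ × ℝ)} (hη : ContDiffOn ℝ ∞ η V)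
    (hξ : ContDiffOn ℝ ∞ ξ V) (hne : ∀ q ∈ V, ξ q ≠ 0) : ContDiffOn ℝ ∞ (formRatio η ξ) V :=
  (((contDiffOn_coeff hη _).mul (contDiffOn_coeff hξ _)).add
    ((contDiffOn_coeff hη _).mul (contDiffOn_coeff hξ _))).div
    (((contDiffOn_coeff hξ _).pow 2).add ((contDiffOn_coeff hξ _).pow 2))
    fun q hq => coeffs_sq_ne_zero (hne q hq)

theorem quadratic_eq_zero_of_eventually {c : Fin 3 → ℝ}
    (h : ∀ᶠ t in 𝓝 (0 : ℝ), c 0 + c 1 * t + c 2 * t ^ 2 = 0) : c = 0 := by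
  obtain ⟨r, hr, hb⟩ := Metric.eventually_nhds_iff.1 h
  have e0 := hb (y := 0) (by simpa using hr)
  have e1 := hb (y := r / 2) (by rw [Real.dist_0_eq_abs, abs_of_pos (by linarith)]; linarith)
  have e2 := hb (y := -(r / 2)) (by
    rw [Real.dist_0_eq_abs, abs_neg, abs_of_pos (by linarith)]; linarith)
  have h0 : c 0 = 0 := by simpa using e0
  have h1 : c 1 = 0 := by
    have : r * c 1 = 0 := by linear_combination e1 - e2
    exact (mul_eq_zero.1 this).resolve_left hr.ne'
  have h2 : c 2 = 0 := by
    have : r ^ 2 * c 2 = 0 := by linear_combination 2 * (e1 + e2) - 4 * h0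
    exact (mul_eq_zero.1 this).resolve_left (pow_ne_zero 2 hr.ne')
  funext i
  fin_cases i
  exacts [h0, h1, h2]

section

variable {D : Set (ℝ × ℝ)} {W : Fin 5 → OneForm} {p : ℝ × ℝ}

/-- The solution of the abelian equation of a web with linear first integrals `ℓ i ∘ φ` that is
given by quadratic polynomials. -/
def polynomialSolution (W : Fin 5 → OneForm) (φ : ℝ × ℝ → ℝ × ℝ) (p : ℝ × ℝ)
    (ℓ : Fin 5 → (ℝ × ℝ →L[ℝ] ℝ)) (c : Fin 5 → Fin 3 → ℝ) (q : ℝ × ℝ) (i : Fin 5) : ℝ :=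
  (c i 0 + c i 1 * ℓ i (φ q - φ p) + c i 2 * ℓ i (φ q - φ p) ^ 2) *
    formRatio (fun q => (ℓ i).comp (fderiv ℝ φ q)) (W i) q

theorem polynomialSolution_add (W : Fin 5 → OneForm) (φ : ℝ × ℝ → ℝ × ℝ) (p : ℝ × ℝ)
    (ℓ : Fin 5 → (ℝ × ℝ →L[ℝ] ℝ)) (c e : Fin 5 → Fin 3 → ℝ) : polynomialSolution W φ p ℓ (c + e) =
      polynomialSolution W φ p ℓ c + polynomialSolution W φ p ℓ e := by
  funext q i
  simp only [polynomialSolution, Pi.add_apply]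
  ring

theorem polynomialSolution_smul (W : Fin 5 → OneForm) (φ : ℝ × ℝ → ℝ × ℝ) (p : ℝ × ℝ)
    (ℓ : Fin 5 → (ℝ × ℝ →L[ℝ] ℝ)) (r : ℝ) (c : Fin 5 → Fin 3 → ℝ) :
    polynomialSolution W φ p ℓ (r • c) = r • polynomialSolution W φ p ℓ c := by
  funext q i
  simp only [polynomialSolution, Pi.smul_apply, smul_eq_mul]
  ring

/-- With `tᵢ = ℓᵢ(φ - φ(p))`, the form `λᵢ Wᵢ` equals `Pᵢ(tᵢ) dtᵢ`, which has the primitive `F`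
below; the moment conditions make these forms sum to zero. -/
theorem isAbelianSolution_polynomialSolution {V : Set (ℝ × ℝ)} (hV : IsOpen V)
    (hW : ∀ i, ContDiffOn ℝ ∞ (W i) V) (hW0 : ∀ i, ∀ q ∈ V, W i q ≠ 0) {φ : ℝ × ℝ → ℝ × ℝ}
    (hφ : ContDiffOn ℝ ∞ φ V) {ℓ : Fin 5 → (ℝ × ℝ →L[ℝ] ℝ)}
    (hker : ∀ i, ∀ q ∈ V, ∀ v, W i q v = 0 → ℓ i (fderiv ℝ φ q v) = 0)
    {c : Fin 5 → Fin 3 → ℝ} (hc : momentMap (fun i => ℓ i (1, 0)) (fun i => ℓ i (0, 1)) c = 0) :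
    IsAbelianSolution W V (polynomialSolution W φ p ℓ c) := by
  have ht : ∀ i, ContDiffOn ℝ ∞ (fun q => ℓ i (φ q - φ p)) V := fun i =>
    (ℓ i).contDiff.comp_contDiffOn (hφ.sub contDiffOn_const)
  have hη : ∀ i, ContDiffOn ℝ ∞ (fun q => (ℓ i).comp (fderiv ℝ φ q)) V := fun i =>
    contDiffOn_const.clm_comp (hφ.fderiv_of_isOpen hV (by simp))
  have hφd : ∀ q ∈ V, HasFDerivAt φ (fderiv ℝ φ q) q := fun q hq =>
    ((hφ.contDiffAt (hV.mem_nhds hq)).differentiableAt (by simp)).hasFDerivAt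
  have htd : ∀ i, ∀ q ∈ V,
      HasFDerivAt (fun q => ℓ i (φ q - φ p)) ((ℓ i).comp (fderiv ℝ φ q)) q := fun i q hq =>
    (ℓ i).hasFDerivAt.comp q ((hφd q hq).sub_const _)
  have hsm : ∀ i, ContDiffOn ℝ ∞ (fun q => polynomialSolution W φ p ℓ c q i) V := fun i =>
    ((contDiffOn_const.add (contDiffOn_const.mul (ht i))).add
      (contDiffOn_const.mul ((ht i).pow 2))).mul (contDiffOn_formRatio (hη i) (hW i) (hW0 i))
  have heq : ∀ i, ∀ q ∈ V, polynomialSolution W φ p ℓ c q i • W i q =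
      (c i 0 + c i 1 * ℓ i (φ q - φ p) + c i 2 * ℓ i (φ q - φ p) ^ 2) •
        (ℓ i).comp (fderiv ℝ φ q) := fun i q hq => by
    rw [polynomialSolution, mul_smul, formRatio_smul (hW0 i q hq) (hker i q hq)]
  refine ⟨contDiffOn_pi.2 hsm, fun q hq => ?_, fun i => ⟨(hsm i).smul (hW i), fun q hq => ?_⟩⟩
  · have e := congrArg (fun m : ℝ × ℝ →L[ℝ] ℝ => m.comp (fderiv ℝ φ q))
      (sum_eq_zero_of_mem_ker_momentMap hc (φ q - φ p))
    simp only [ContinuousLinearMap.zero_comp] at e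
    rw [← e, Finset.sum_congr rfl fun i _ => heq i q hq]
    apply clm_eq_of_coeffs <;> simp [sum_apply]
  · let F : ℝ × ℝ → ℝ := fun q => c i 0 * ℓ i (φ q - φ p) +
      c i 1 * (ℓ i (φ q - φ p) ^ 2 * (2⁻¹ : ℝ)) + c i 2 * (ℓ i (φ q - φ p) ^ 3 * (3⁻¹ : ℝ))
    have hF : ContDiffOn ℝ ∞ F V := ((contDiffOn_const.mul (ht i)).add
      (contDiffOn_const.mul (((ht i).pow 2).mul contDiffOn_const))).add
      (contDiffOn_const.mul (((ht i).pow 3).mul contDiffOn_const))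
    rw [dForm_congr hV (θ := fderiv ℝ F) (fun x hx => ?_) hq, dForm_fderiv hV hF hq]
    have hd := (((htd i x hx).const_mul (c i 0)).add
      ((((htd i x hx).pow 2).mul_const (2⁻¹ : ℝ)).const_mul (c i 1))).add
      ((((htd i x hx).pow 3).mul_const (3⁻¹ : ℝ)).const_mul (c i 2))
    have hd' : HasFDerivAt F _ x := hd
    rw [hd'.fderiv, heq i x hx]
    apply clm_eq_of_coeffs <;> simp <;> ring

theorem IsWeb.form_ne_zero {d : ℕ} {W : Fin (d + 2) → OneForm} (hW : IsWeb D W) {q : ℝ × ℝ}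
    (hq : q ∈ D) (i : Fin (d + 2)) : W i q ≠ 0 := by
  obtain ⟨j, hj⟩ := exists_ne i
  exact (hW.transversal q hq i j hj.symm).ne_zero 0

/-- The upper bound is `rankAt_le`. For the lower bound, the kernel of the moment map has dimension
at least six and injects into the solution germs. -/
theorem IsNormalizedWeb.rankAt_eq_six {s : Fin 5 → ℝ × ℝ → ℝ} {a b : ℝ}
    (hn : IsNormalizedWeb D W s a b) (hp : p ∈ D) (h : IsParallelizableAt D W p) :
    rankAt W p = 6 := by
  refine le_antisymm (hn.rankAt_le hp) ?_
  obtain ⟨φ, hpφ, hφD, hφ, hφ', ℓ, hℓ, hker⟩ := h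
  have hV := φ.open_source
  have hW0 : ∀ i, ∀ q ∈ φ.source, W i q ≠ 0 := fun i q hq => hn.isWeb.form_ne_zero (hφD hq) i
  have hW : ∀ i, ContDiffOn ℝ ∞ (W i) φ.source := fun i => (hn.isWeb.smooth i).mono hφD
  let R := momentMap (fun i => ℓ i (1, 0)) (fun i => ℓ i (0, 1))
  have hsol : ∀ c : LinearMap.ker R,
      IsAbelianSolution W φ.source (polynomialSolution W φ p ℓ c) := fun c =>
    isAbelianSolution_polynomialSolution hV hW hW0 hφ (fun i q hq v => (hker i q hq v).1) c.2
  let Φ : LinearMap.ker R →ₗ[ℝ] solutionGerms W p :=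
    { toFun := fun c => ⟨(polynomialSolution W φ p ℓ c : (𝓝 p).Germ (Fin 5 → ℝ)),
        φ.source, hV, hpφ, _, hsol c, rfl⟩
      map_add' := fun c e => Subtype.ext (congrArg
        (fun f : ℝ × ℝ → Fin 5 → ℝ => (f : (𝓝 p).Germ (Fin 5 → ℝ)))
        (polynomialSolution_add W φ p ℓ c e))
      map_smul' := fun r c => Subtype.ext (congrArg
        (fun f : ℝ × ℝ → Fin 5 → ℝ => (f : (𝓝 p).Germ (Fin 5 → ℝ)))
        (polynomialSolution_smul W φ p ℓ r c)) }
  have hΦ : Function.Injective Φ := by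
    refine (injective_iff_map_eq_zero _).2 fun c hc => Subtype.ext (funext fun i => ?_)
    have hz : polynomialSolution W φ p ℓ c =ᶠ[𝓝 p] 0 :=
      Filter.Germ.coe_eq.1 (congrArg Subtype.val hc)
    obtain ⟨v, hv⟩ : ∃ v, ℓ i v ≠ 0 := by
      by_contra! hv
      exact hℓ i (ContinuousLinearMap.ext hv)
    -- Along the curve `φ⁻¹(φ(p) + t e)` the `i`-th first integral is `t`. A zero germ thus makes
    -- the `i`-th quadratic polynomial vanish near `t = 0`, since the ratio of two nonzero forms is
    -- nonzero.
    set e := (ℓ i v)⁻¹ • v with he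
    have hle : ℓ i e = 1 := by rw [he, map_smul, smul_eq_mul, inv_mul_cancel₀ hv]
    have hline : Filter.Tendsto (fun t : ℝ => φ p + t • e) (𝓝 0) (𝓝 (φ p)) := by
      have : Continuous fun t : ℝ => φ p + t • e := by fun_prop
      simpa using this.tendsto 0
    have hψ : Filter.Tendsto (fun t : ℝ => φ.symm (φ p + t • e)) (𝓝 0) (𝓝 p) := by
      have h1 := (φ.continuousAt_symm (φ.map_source hpφ)).tendsto
      rw [φ.left_inv hpφ] at h1
      exact h1.comp hline
    refine quadratic_eq_zero_of_eventually ?_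
    filter_upwards [hψ.eventually hz, hψ.eventually (hV.mem_nhds hpφ),
      hline.eventually (φ.open_target.mem_nhds (φ.map_source hpφ))] with t h1 h2 h3
    have e1 := congrFun h1 i
    simp only [polynomialSolution, Pi.zero_apply, φ.right_inv h3, add_sub_cancel_left, map_smul, hle,
      smul_eq_mul, mul_one] at e1
    refine (mul_eq_zero.1 e1).resolve_right fun h0 => ?_
    have hk := formRatio_smul (η := fun q => (ℓ i).comp (fderiv ℝ φ q)) (hW0 i _ h2)
      (fun v => (hker i _ h2 v).1)
    rw [h0, zero_smul] at hk
    refine hW0 i _ h2 (ContinuousLinearMap.ext fun v => ?_)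
    exact (hker i _ h2 v).2 (congrArg (fun m : ℝ × ℝ →L[ℝ] ℝ => m v) hk.symm)
  have := hn.finite_solutionGerms hp
  exact (six_le_finrank_ker_momentMap _ _).trans (LinearMap.finrank_le_finrank_of_injective hΦ)

end

end PlanarWeb

end

/-! ### The theorem -/

theorem mainTheorem12 (D : Set (ℝ × ℝ)) (W : Fin 5 → PlanarWeb.OneForm)
    (hW : PlanarWeb.IsWeb D W) (a b : ℝ)
    (ha : ∀ q ∈ D, PlanarWeb.basicInvariant W 3 q = a)
    (hb : ∀ q ∈ D, PlanarWeb.basicInvariant W 4 q = b) :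
    (∀ p ∈ D, PlanarWeb.rankAt W p = 6 ↔ PlanarWeb.IsParallelizableAt D W p) ∧
    (∃ θ : Fin 5 → PlanarWeb.OneForm,
      PlanarWeb.IsNormalization D W θ (fun _ => a) (fun _ => b)) ∧
    ∀ (U : Set (ℝ × ℝ)) (θ : Fin 5 → PlanarWeb.OneForm), IsOpen U → U ⊆ D →
      PlanarWeb.IsNormalization U W θ (fun _ => a) (fun _ => b) →
      ∃ c : ℝ × ℝ → Fin 6 → ℝ,
        (∀ q ∈ U, ∀ c' : Fin 6 → ℝ,
          PlanarWeb.IsObstructionAt U (θ 0) (θ 1) (fun _ => a) (fun _ => b) q c' ↔ c' = c q) ∧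
        (∀ q ∈ U,
          let K := PlanarWeb.curvature (θ 0) (θ 1) q
          let K₁ := PlanarWeb.curvatureD (θ 0) (θ 1) 0 q
          let K₂ := PlanarWeb.curvatureD (θ 0) (θ 1) 1 q
          let K₁₁ := PlanarWeb.curvatureDD (θ 0) (θ 1) 0 0 q
          let K₁₂ := PlanarWeb.curvatureDD (θ 0) (θ 1) 0 1 q
          let K₂₂ := PlanarWeb.curvatureDD (θ 0) (θ 1) 1 1 q
          c q 0 = K ∧
          c q 1 = (b * K₂ - K₁) / (2 * (b - 1)) ∧
          c q 2 = b * (a - b) * (K₂ - K₁) / (2 * (a - 1) * (b - 1)) ∧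
          c q 3 = (K₁₁ - (a + b) * K₁₂ + a * b * K₂₂ + 5 * (a + b - 2) * K ^ 2) /
            (10 * (a - 1) * (b - 1)) ∧
          c q 4 = a * (K₁₁ - (b + 1) * K₁₂ + b * K₂₂ + 5 * (b - 1) * K ^ 2) /
            (10 * (a - 1) * (b - 1)) ∧
          c q 5 = b * (K₁₁ - (a + 1) * K₁₂ + a * K₂₂ + 5 * (a - 1) * K ^ 2) /
            (10 * (a - 1) * (b - 1))) ∧
        ((∀ q ∈ U, ∀ i, c q i = 0) ↔ ∀ q ∈ U, PlanarWeb.curvature (θ 0) (θ 1) q = 0) := by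
  have hscale : ∃ s : Fin 5 → ℝ × ℝ → ℝ, PlanarWeb.IsNormalizedWeb D W s a b := by
    obtain ⟨s, hs, hs0, hN⟩ := hW.exists_scaling ha hb
    exact ⟨s, hW, hs, hs0, hN⟩
  obtain ⟨s, hn⟩ := hscale
  refine ⟨fun p hp => ⟨fun hr => hn.isParallelizableAt hp (hn.curvature_eventually_eq_zero hp hr),
    fun h => hn.rankAt_eq_six hp h⟩, ⟨_, hn.isNormalization⟩, fun U θ hU hUD hN => ?_⟩
  have hc := hN.isCoframe hW hU hUD
  refine ⟨PlanarWeb.obstructionCoeff (θ 0) (θ 1) a b, fun q hq c' => ?_,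
    fun q _ => ⟨rfl, rfl, rfl, rfl, rfl, rfl⟩, PlanarWeb.obstructionCoeff_eq_zero_iff hc a b⟩
  -- Nondegeneracy of the constants is extracted at a point of `U`, as `U` may be empty.
  obtain ⟨a0, b0, a1, b1, hab⟩ := hN.nondegenerate hW hUD hq
  exact PlanarWeb.isObstructionAt_iff hc hq a0 b0 a1 b1 hab c'
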